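/- Let $\lambda\in\{1,-1\}$, and let $X_\lambda$ be the unit sphere $\mathbf S^3$ if $\lambda=1$ and hyperbolic 3-space $\mathbf H^3$ if $\lambda=-1$. Consider non-degenerate tetrahedra in $X_\lambda$ with labelled vertices $v_1,v_2,v_3,v_4$ (in the sphere model in $\mathbb R^4$, respectively the hyperboloid model in $\mathbb R^{3,1}$, the four vertices are linearly independent vectors). For an edge $v_iv_j$ let $x_{ij}$ be its length and $a_{ij}$ the dihedral angle at it; put $x_{ji}=x_{ij}$, $a_{ji}=a_{ij}$. Let $\sqrt\lambda=1$ if $\lambda=1$ and $\sqrt\lambda=\sqrt{-1}$ if $\lambda=-1$. For every such tetrahedron the lengths are determined by the six dihedral angles, the six-tuples of angles near that of the given tetrahedron are also the dihedral angles of tetrahedra in $X_\lambda$, and the lengths are differentiable functions of the six angles there; moreover $\sin(\sqrt\lambda\,x_{ij})\ne 0$ for every edge. Define $$R^{ij}_{rs}=\frac{1}{\sin(\sqrt\lambda\,x_{ij})\,\sin(\sqrt\lambda\,x_{rs})}\,\frac{\partial x_{ij}}{\partial a_{rs}} .$$ Then, for every such tetrahedron and all pairwise distinct indices $i,j,k,l$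 (so $\{i,j,k,l\}=\{1,2,3,4\}$): (i) $R^{ij}_{rs}=R^{rs}_{ij}$ for all edges $ij$, $rs$. (ii) $R^{ij}_{kl}=R^{ik}_{jl}=R^{il}_{jk}$. (iii) $R^{ij}_{ik}=R^{ij}_{kl}\,\cos(\sqrt\lambda\,x_{il})$. (iv) $R^{ij}_{ij}=R^{ij}_{kl}\,w_{ij}$, where, with $c_{rs}=\cos(\sqrt\lambda\,x_{rs})$, $$w_{ij}=\frac{-c_{ij}c_{ik}c_{il}-c_{ji}c_{jk}c_{jl}+c_{ik}c_{jl}+c_{il}c_{jk}}{\sin^2(\sqrt\lambda\,x_{ij})}.$$ (v) $R^{ij}_{rs}=R^{i'j'}_{r's'}$ whenever $\{i,j\}\ne\{r,s\}$, where for a two-element set $\{a,b\}\subset\{1,2,3,4\}$ the set $\{a',b'\}$ is its complement. -/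

import Mathlib

namespace ConstCurv

/-- The two three-dimensional geometries of non-zero constant curvature. -/
inductive Geometry3 where
  | spherical
  | hyperbolic

namespace Geometry3

/-- The curvature: `1` for `S³` and `-1` for `H³`. -/
def curv : Geometry3 → ℝ
  | spherical => 1
  | hyperbolic => -1

/-- The complex number `√curv`: `1` for `S³` and the imaginary unit for `H³`. -/
noncomputable def sqrtCurv : Geometry3 → ℂ
  | spherical => 1
  | hyperbolic => Complex.I

/-- The ambient bilinear form on `ℝ⁴`: the Euclidean inner product in the spherical case, the
Lorentzian product `-x₀y₀ + x₁y₁ + x₂y₂ + x₃y₃` in the hyperbolic case. -/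
def form (κ : Geometry3) (x y : Fin 4 → ℝ) : ℝ :=
  κ.curv * (x 0 * y 0) + x 1 * y 1 + x 2 * y 2 + x 3 * y 3

/-- The unit sphere `S³`, and the upper sheet of the hyperboloid as a model of `H³`. -/
def space (κ : Geometry3) : Set (Fin 4 → ℝ) :=
  match κ with
  | spherical => {x | form spherical x x = 1}
  | hyperbolic => {x | form hyperbolic x x = -1 ∧ 0 < x 0}

/-- The geodesic distance. -/
noncomputable def gdist (κ : Geometry3) (x y : Fin 4 → ℝ) : ℝ :=
  match κ with
  | spherical => Real.arccos (form spherical x y)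
  | hyperbolic => Real.arcosh (-form hyperbolic x y)

/-- The component of `w` orthogonal to `u`. If `u` and `w` are points of the space, this is
a tangent vector at `u` pointing along the geodesic from `u` to `w`. -/
noncomputable def perp (κ : Geometry3) (u w : Fin 4 → ℝ) : Fin 4 → ℝ :=
  w - (κ.form w u / κ.form u u) • u

/-- The angle between two vectors of a subspace on which the form is positive definite, such as
a tangent space. -/
noncomputable def angle (κ : Geometry3) (x y : Fin 4 → ℝ) : ℝ :=
  Real.arccos (κ.form x y / (√(κ.form x x) * √(κ.form y y)))

/-- The dihedral angle at the edge `pq` between the faces `pqr` and `pqs`. In the tangent space at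
`p`, let `t_q, t_r, t_s` be the directions of the edges to `q, r, s`; the angle is that between
the components of `t_r` and `t_s` orthogonal to `t_q`. -/
noncomputable def dihedral (κ : Geometry3) (p q r s : Fin 4 → ℝ) : ℝ :=
  κ.angle (κ.perp (κ.perp p q) (κ.perp p r)) (κ.perp (κ.perp p q) (κ.perp p s))

end Geometry3

/-- The six edges of a tetrahedron: two-element subsets of the set of vertex labels. -/
abbrev Edge : Type := {e : Finset (Fin 4) // e.card = 2}

/-- The edge `{i, j}`. -/
def edge {i j : Fin 4} (h : i ≠ j) : Edge := ⟨{i, j}, Finset.card_pair h⟩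

namespace Edge

/-- The opposite edge, given by the complementary pair of labels. -/
def opp (e : Edge) : Edge :=
  ⟨(e.1)ᶜ, by rw [Finset.card_compl, e.2]; rfl⟩

theorem nonempty (e : Edge) : e.1.Nonempty := Finset.card_pos.mp (by rw [e.2]; norm_num)

/-- The smaller label of an edge. -/
def fst (e : Edge) : Fin 4 := e.1.min' e.nonempty

/-- The larger label of an edge. -/
def snd (e : Edge) : Fin 4 := e.1.max' e.nonempty

end Edge

/-- A non-degenerate tetrahedron in `S³` or `H³` with labelled vertices. -/
structure Tetrahedron (κ : Geometry3) where
  vertex : Fin 4 → Fin 4 → ℝ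
  vertex_mem : ∀ i, vertex i ∈ κ.space
  linearIndependent : LinearIndependent ℝ vertex

namespace Tetrahedron

variable {κ : Geometry3}

/-- The six edge lengths `x_ij`. -/
noncomputable def lengths (T : Tetrahedron κ) (e : Edge) : ℝ :=
  κ.gdist (T.vertex e.fst) (T.vertex e.snd)

/-- The six dihedral angles `a_ij`. The order in which the end points of the edge, and the two
other vertices, are listed does not matter: see `angles_edge`. -/
noncomputable def angles (T : Tetrahedron κ) (e : Edge) : ℝ :=
  κ.dihedral (T.vertex e.fst) (T.vertex e.snd) (T.vertex e.opp.fst) (T.vertex e.opp.snd)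

end Tetrahedron

open Classical in
/-- The edge lengths as functions of the six dihedral angles: the edge lengths of a tetrahedron
with dihedral angles `a`, if there is one. -/
noncomputable def lengthsOfAngles (κ : Geometry3) (a : Edge → ℝ) : Edge → ℝ :=
  if h : ∃ T : Tetrahedron κ, T.angles = a then h.choose.lengths else 0

namespace Tetrahedron

variable {κ : Geometry3}

/-- The partial derivative `∂x_e / ∂a_f` at the dihedral angles of `T`. -/
noncomputable def dLength (T : Tetrahedron κ) (e f : Edge) : ℝ :=
  fderiv ℝ (fun a => lengthsOfAngles κ a e) T.angles (Pi.single f 1)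

/-- `sin (√curv * x_e)`. -/
noncomputable def sinLength (T : Tetrahedron κ) (e : Edge) : ℂ :=
  Complex.sin (κ.sqrtCurv * (T.lengths e : ℂ))

/-- `cos (√curv * x_e)`. -/
noncomputable def cosLength (T : Tetrahedron κ) (e : Edge) : ℂ :=
  Complex.cos (κ.sqrtCurv * (T.lengths e : ℂ))

/-- The normalized partial derivative `R^e_f`. -/
noncomputable def R (T : Tetrahedron κ) (e f : Edge) : ℂ :=
  1 / (T.sinLength e * T.sinLength f) * (T.dLength e f : ℂ)

end Tetrahedron

/-! The lengths and angles do not depend on the order in which vertices are listed. -/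

theorem Geometry3.form_comm (κ : Geometry3) (x y : Fin 4 → ℝ) : κ.form x y = κ.form y x := by
  simp only [Geometry3.form]; ring

theorem Geometry3.form_self (κ : Geometry3) {x : Fin 4 → ℝ} (hx : x ∈ κ.space) :
    κ.form x x = κ.curv := by
  cases κ with
  | spherical => exact hx
  | hyperbolic => exact hx.1

theorem Geometry3.form_pos (κ : Geometry3) {u t : Fin 4 → ℝ} (hu : κ.form u u = κ.curv)
    (h : κ.form t u = 0) (ht : t ≠ 0) : 0 < κ.form t t := by
  cases κ with
  | spherical =>
    simp only [Geometry3.form, Geometry3.curv] at *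
    by_contra hc
    apply ht
    funext m
    have h0 : t 0 = 0 := by nlinarith [sq_nonneg (t 0), sq_nonneg (t 1), sq_nonneg (t 2), sq_nonneg (t 3)]
    have h1 : t 1 = 0 := by nlinarith [sq_nonneg (t 0), sq_nonneg (t 1), sq_nonneg (t 2), sq_nonneg (t 3)]
    have h2 : t 2 = 0 := by nlinarith [sq_nonneg (t 0), sq_nonneg (t 1), sq_nonneg (t 2), sq_nonneg (t 3)]
    have h3 : t 3 = 0 := by nlinarith [sq_nonneg (t 0), sq_nonneg (t 1), sq_nonneg (t 2), sq_nonneg (t 3)]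
    fin_cases m <;> assumption
  | hyperbolic =>
    simp only [Geometry3.form, Geometry3.curv] at *
    by_contra hc
    apply ht
    have hcs : (t 1 * u 1 + t 2 * u 2 + t 3 * u 3) ^ 2 ≤
        (t 1 ^ 2 + t 2 ^ 2 + t 3 ^ 2) * (u 1 ^ 2 + u 2 ^ 2 + u 3 ^ 2) := by
      nlinarith [sq_nonneg (t 1 * u 2 - t 2 * u 1), sq_nonneg (t 1 * u 3 - t 3 * u 1),
        sq_nonneg (t 2 * u 3 - t 3 * u 2)]
    have e1 : t 1 * u 1 + t 2 * u 2 + t 3 * u 3 = t 0 * u 0 := by linarith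
    have e2 : u 0 ^ 2 = u 1 ^ 2 + u 2 ^ 2 + u 3 ^ 2 + 1 := by linarith
    have e3 : t 1 ^ 2 + t 2 ^ 2 + t 3 ^ 2 ≤ t 0 ^ 2 := by linarith
    have e4 : t 0 ^ 2 * u 0 ^ 2 ≤ t 0 ^ 2 * (u 0 ^ 2 - 1) := by
      calc t 0 ^ 2 * u 0 ^ 2 = (t 1 * u 1 + t 2 * u 2 + t 3 * u 3) ^ 2 := by rw [e1]; ring
        _ ≤ _ := hcs
        _ = (t 1 ^ 2 + t 2 ^ 2 + t 3 ^ 2) * (u 0 ^ 2 - 1) := by rw [e2]; ring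
        _ ≤ _ := mul_le_mul_of_nonneg_right e3 (by rw [e2]; nlinarith [sq_nonneg (u 1), sq_nonneg (u 2), sq_nonneg (u 3)])
    have f0 : t 0 ^ 2 ≤ 0 := by linarith
    have h0 : t 0 = 0 := pow_eq_zero_iff two_ne_zero |>.mp (le_antisymm f0 (sq_nonneg _))
    have q1 := sq_nonneg (t 1)
    have q2 := sq_nonneg (t 2)
    have q3 := sq_nonneg (t 3)
    have h1 : t 1 = 0 := pow_eq_zero_iff two_ne_zero |>.mp (le_antisymm (by linarith) q1)
    have h2 : t 2 = 0 := pow_eq_zero_iff two_ne_zero |>.mp (le_antisymm (by linarith) q2)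
    have h3 : t 3 = 0 := pow_eq_zero_iff two_ne_zero |>.mp (le_antisymm (by linarith) q3)
    funext m
    fin_cases m <;> assumption

theorem Geometry3.form_perp_perp (κ : Geometry3) {p q : Fin 4 → ℝ} (hp : κ.form p p = κ.curv)
    (hq : κ.form q q = κ.curv) (hpq : LinearIndependent ℝ ![p, q]) (w : Fin 4 → ℝ) :
    κ.perp (κ.perp p q) (κ.perp p w) = κ.perp (κ.perp q p) (κ.perp q w) := by
  have hs : κ.curv * κ.curv = 1 := by cases κ <;> simp [Geometry3.curv]
  have hs0 : κ.curv ≠ 0 := by intro h; simp [h] at hs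
  have hsub : ∀ (x y z : Fin 4 → ℝ) (c : ℝ), κ.form (x - c • y) z = κ.form x z - c * κ.form y z := by
    intro x y z c; simp only [Geometry3.form, Pi.sub_apply, Pi.smul_apply, smul_eq_mul]; ring
  have hsub' : ∀ (x y z : Fin 4 → ℝ) (c : ℝ), κ.form z (x - c • y) = κ.form z x - c * κ.form z y := by
    intro x y z c; simp only [Geometry3.form, Pi.sub_apply, Pi.smul_apply, smul_eq_mul]; ring
  have hpos : 0 < κ.form (κ.perp p q) (κ.perp p q) := by
    refine κ.form_pos hp ?_ ?_
    · simp only [Geometry3.perp, hsub, hp]; field_simp; ring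
    · intro h0
      have := LinearIndependent.pair_iff.mp hpq (-(κ.form q p / κ.form p p)) 1 (by
        rw [← h0, Geometry3.perp]; module)
      simp at this
  have hb : κ.form q p ^ 2 ≠ 1 := by
    intro hb
    simp only [Geometry3.perp, hsub, hsub', hp, hq, κ.form_comm p q, div_mul_cancel₀ _ hs0] at hpos
    have : κ.form q p / κ.curv * κ.form q p = κ.curv := by
      rw [div_mul_eq_mul_div, ← pow_two, hb, div_eq_iff hs0, hs]
    linarith
  have hb' : 1 - κ.form q p ^ 2 ≠ 0 := fun h => hb (by linarith)
  have hb'' : -1 + κ.form q p ^ 2 ≠ 0 := fun h => hb (by linarith)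
  have hc : κ.curv = 1 ∨ κ.curv = -1 := by cases κ <;> simp [Geometry3.curv]
  funext m
  simp only [Geometry3.perp, hsub, hsub', hp, hq, κ.form_comm p q, Pi.sub_apply, Pi.smul_apply,
    smul_eq_mul]
  generalize κ.form q p = b at *
  generalize κ.form w p = x at *
  generalize κ.form w q = y at *
  rcases hc with hc | hc
  · have e : 1 - b / 1 * b - b / 1 * (b - b / 1 * 1) = 1 - b ^ 2 := by ring
    simp only [hc, e]
    field_simp
    ring
  · have e : -1 - b / -1 * b - b / -1 * (b - b / -1 * -1) = -1 + b ^ 2 := by ring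
    simp only [hc, e]
    field_simp
    ring

theorem Geometry3.gdist_comm (κ : Geometry3) (x y : Fin 4 → ℝ) : κ.gdist x y = κ.gdist y x := by
  cases κ <;> simp only [Geometry3.gdist, Geometry3.form_comm _ x y]

theorem Geometry3.angle_comm (κ : Geometry3) (x y : Fin 4 → ℝ) : κ.angle x y = κ.angle y x := by
  simp only [Geometry3.angle, κ.form_comm x y, mul_comm]

theorem edge_cases {i j : Fin 4} (h : i ≠ j) :
    (edge h).fst = i ∧ (edge h).snd = j ∨ (edge h).fst = j ∧ (edge h).snd = i := by
  revert i j; decide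

theorem edge_opp {i j k l : Fin 4} (hij : i ≠ j) (hik : i ≠ k) (hil : i ≠ l) (hjk : j ≠ k)
    (hjl : j ≠ l) (hkl : k ≠ l) : (edge hij).opp = edge hkl := by
  revert i j k l; decide

theorem Tetrahedron.lengths_edge {κ : Geometry3} (T : Tetrahedron κ) {i j : Fin 4} (h : i ≠ j) :
    T.lengths (edge h) = κ.gdist (T.vertex i) (T.vertex j) := by
  rcases edge_cases h with ⟨h1, h2⟩ | ⟨h1, h2⟩
  · rw [Tetrahedron.lengths, h1, h2]
  · rw [Tetrahedron.lengths, h1, h2, Geometry3.gdist_comm]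

theorem Tetrahedron.angles_edge {κ : Geometry3} (T : Tetrahedron κ) {i j k l : Fin 4}
    (hij : i ≠ j) (hik : i ≠ k) (hil : i ≠ l) (hjk : j ≠ k) (hjl : j ≠ l) (hkl : k ≠ l) :
    T.angles (edge hij) =
      κ.dihedral (T.vertex i) (T.vertex j) (T.vertex k) (T.vertex l) := by
  have hpq : LinearIndependent ℝ ![T.vertex i, T.vertex j] := by
    have := T.linearIndependent.comp ![i, j] (by
      intro a b hab; fin_cases a <;> fin_cases b <;> simp_all [eq_comm])
    convert this using 1
    funext a; fin_cases a <;> rfl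
  have hi := κ.form_self (T.vertex_mem i)
  have hj := κ.form_self (T.vertex_mem j)
  rw [Tetrahedron.angles, edge_opp hij hik hil hjk hjl hkl]
  simp only [Geometry3.dihedral]
  rcases edge_cases hij with ⟨h1, h2⟩ | ⟨h1, h2⟩ <;>
    rcases edge_cases hkl with ⟨h3, h4⟩ | ⟨h3, h4⟩ <;> rw [h1, h2, h3, h4]
  · rw [Geometry3.angle_comm]
  · rw [κ.form_perp_perp hi hj hpq, κ.form_perp_perp hi hj hpq]
  · rw [κ.form_perp_perp hi hj hpq, κ.form_perp_perp hi hj hpq, Geometry3.angle_comm]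

end ConstCurv

open ConstCurv

namespace ConstCurv

/-! ### The bilinear form and the Gram matrix -/

/-! Let G be the Gram matrix of the vertices. Its off-diagonal entries encode the lengths, since
c_ij = curv * G_ij. Projecting away from v_i and v_j replaces G by a 2×2 Schur complement, whose
inverse is the {k,l} block of G⁻¹; so G⁻¹, rescaled to unit diagonal, has -cos a_ij at place kl
(`angleMatrix_angles`). Inverting and rescaling again recovers G (`normalizedInv_angleMatrix`),
which makes the lengths explicit functions of the angles. These formulas hold near the given angles
because every symmetric matrix near G is again the Gram matrix of a tetrahedron
(`eventually_exists_mul_mul_transpose`, `range_angles_mem_nhds`). Moving a_ij changes the angle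
matrix A only at kl and lk, so (A⁻¹)' = -A⁻¹A'A⁻¹ is a sum of products of two entries of A⁻¹.
Inserting sin a_ij cancels all scaling factors, and `R_edge` gives R as a polynomial in G over (1 -
G_pq²)√(curv det G). For opposite edges this collapses to 1/√(curv det G), for adjacent ones to curv
* G_il/√(curv det G); the symmetries can be read off, and the diagonal case is the numerator of
w_ij. -/

theorem Geometry3.curv_mul_self (κ : Geometry3) : κ.curv * κ.curv = 1 := by
  cases κ <;> simp [Geometry3.curv]

theorem Geometry3.curv_ne_zero (κ : Geometry3) : κ.curv ≠ 0 := by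
  cases κ <;> simp [Geometry3.curv]

theorem Geometry3.form_sub_smul_left (κ : Geometry3) (x y z : Fin 4 → ℝ) (c : ℝ) :
    κ.form (x - c • y) z = κ.form x z - c * κ.form y z := by
  simp only [Geometry3.form, Pi.sub_apply, Pi.smul_apply, smul_eq_mul]; ring

theorem Geometry3.form_sub_smul_right (κ : Geometry3) (x y z : Fin 4 → ℝ) (c : ℝ) :
    κ.form z (x - c • y) = κ.form z x - c * κ.form z y := by
  simp only [Geometry3.form, Pi.sub_apply, Pi.smul_apply, smul_eq_mul]; ring

theorem Geometry3.form_perp_left (κ : Geometry3) {u : Fin 4 → ℝ} (hu : κ.form u u ≠ 0)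
    (w : Fin 4 → ℝ) : κ.form (κ.perp u w) u = 0 := by
  rw [Geometry3.perp, Geometry3.form_sub_smul_left]; field_simp; ring

/-- The matrix of the ambient bilinear form. -/
def Geometry3.ambient (κ : Geometry3) : Matrix (Fin 4) (Fin 4) ℝ :=
  Matrix.diagonal ![κ.curv, 1, 1, 1]

theorem Geometry3.ambient_mul_self (κ : Geometry3) : κ.ambient * κ.ambient = 1 := by
  rw [Geometry3.ambient, Matrix.diagonal_mul_diagonal, ← Matrix.diagonal_one]
  congr 1
  funext i
  fin_cases i <;> simp [κ.curv_mul_self]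

theorem Geometry3.ambient_transpose (κ : Geometry3) : κ.ambient.transpose = κ.ambient :=
  Matrix.diagonal_transpose _

theorem Geometry3.det_ambient (κ : Geometry3) : κ.ambient.det = κ.curv := by
  simp [Geometry3.ambient, Matrix.det_diagonal, Fin.prod_univ_four]

theorem Geometry3.mul_ambient_mul_transpose (κ : Geometry3) (V W : Matrix (Fin 4) (Fin 4) ℝ)
    (p q : Fin 4) : (V * κ.ambient * W.transpose) p q = κ.form (V p) (W q) := by
  simp only [Geometry3.ambient, Matrix.mul_apply, Matrix.transpose_apply,
    Fin.sum_univ_four, Geometry3.form]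
  simp
  ring

namespace Tetrahedron

variable {κ : Geometry3} (T : Tetrahedron κ)

/-- The Gram matrix of the vertices. -/
def gram : Matrix (Fin 4) (Fin 4) ℝ := Matrix.of fun p q => κ.form (T.vertex p) (T.vertex q)

theorem gram_apply (p q : Fin 4) : T.gram p q = κ.form (T.vertex p) (T.vertex q) := rfl

theorem gram_self (p : Fin 4) : T.gram p p = κ.curv := κ.form_self (T.vertex_mem p)

theorem gram_comm (p q : Fin 4) : T.gram p q = T.gram q p := κ.form_comm _ _

theorem gram_eq_mul :
    T.gram = Matrix.of T.vertex * κ.ambient * (Matrix.of T.vertex).transpose := by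
  ext p q
  rw [κ.mul_ambient_mul_transpose]
  rfl

theorem det_vertex_ne_zero : (Matrix.of T.vertex).det ≠ 0 := by
  have h : IsUnit (Matrix.of T.vertex) :=
    Matrix.linearIndependent_rows_iff_isUnit.mp T.linearIndependent
  exact ((Matrix.isUnit_iff_isUnit_det _).mp h).ne_zero

/-- By G = V J Vᵀ, multiplied by the curvature the determinant becomes the square of det V. -/
theorem curv_mul_det_gram_pos : 0 < κ.curv * T.gram.det := by
  have h : κ.curv * T.gram.det = (Matrix.of T.vertex).det ^ 2 := by
    rw [gram_eq_mul, Matrix.det_mul, Matrix.det_mul, Matrix.det_transpose, κ.det_ambient]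
    linear_combination (Matrix.of T.vertex).det ^ 2 * κ.curv_mul_self
  rw [h]
  have := T.det_vertex_ne_zero
  positivity

theorem det_gram_ne_zero : T.gram.det ≠ 0 := fun h => by
  simpa [h] using T.curv_mul_det_gram_pos

/-- This is the form evaluated at the component of v_j orthogonal to v_i, a nonzero tangent vector
at v_i. Its value is sin² or sinh² of the length. -/
theorem curv_mul_one_sub_gram_sq_pos {i j : Fin 4} (hij : i ≠ j) :
    0 < κ.curv * (1 - T.gram i j ^ 2) := by
  have hpq : LinearIndependent ℝ ![T.vertex i, T.vertex j] := by
    have := T.linearIndependent.comp ![i, j] (by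
      intro a b hab; fin_cases a <;> fin_cases b <;> simp_all [eq_comm])
    convert this using 1
    funext a; fin_cases a <;> rfl
  have hi := κ.form_self (T.vertex_mem i)
  have hj := κ.form_self (T.vertex_mem j)
  have hpos := κ.form_pos hi (κ.form_perp_left (hi ▸ κ.curv_ne_zero) (T.vertex j)) (by
    intro h0
    have := LinearIndependent.pair_iff.mp hpq
      (-(κ.form (T.vertex j) (T.vertex i) / κ.form (T.vertex i) (T.vertex i))) 1 (by
        rw [← h0, Geometry3.perp]; module)
    simp at this)
  simp only [Geometry3.perp, κ.form_sub_smul_left, κ.form_sub_smul_right, hi, hj,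
    κ.form_comm (T.vertex j) (T.vertex i), div_mul_cancel₀ _ κ.curv_ne_zero] at hpos
  rw [gram_apply]
  convert hpos using 1
  have := κ.curv_ne_zero
  field_simp
  linear_combination (κ.form (T.vertex i) (T.vertex j) ^ 2 * (-1)) * κ.curv_mul_self

end Tetrahedron

/-! ### Four distinct labels -/

theorem sum_four_distinct {i j k l : Fin 4} (hij : i ≠ j) (hik : i ≠ k) (hil : i ≠ l)
    (hjk : j ≠ k) (hjl : j ≠ l) (hkl : k ≠ l) (f : Fin 4 → ℝ) :
    ∑ q, f q = f i + f j + f k + f l := by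
  have h : (Finset.univ : Finset (Fin 4)) = {i, j, k, l} := by
    revert i j k l; decide
  rw [h, Finset.sum_insert (by simp [hij, hik, hil]), Finset.sum_insert (by simp [hjk, hjl]),
    Finset.sum_insert (by simp [hkl]), Finset.sum_singleton]
  ring

theorem det_four_distinct {i j k l : Fin 4} (hij : i ≠ j) (hik : i ≠ k) (hil : i ≠ l)
    (hjk : j ≠ k) (hjl : j ≠ l) (hkl : k ≠ l) (M : Matrix (Fin 4) (Fin 4) ℝ) :
    M.det = (!![M i i, M i j, M i k, M i l; M j i, M j j, M j k, M j l;
      M k i, M k j, M k k, M k l; M l i, M l j, M l k, M l l]).det := by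
  have hσ : Function.Injective ![i, j, k, l] := by
    intro a b hab
    fin_cases a <;> fin_cases b <;> simp_all [eq_comm]
  rw [← Matrix.det_submatrix_equiv_self
    (Equiv.ofBijective _ (Finite.injective_iff_bijective.mp hσ)) M]
  congr 1
  ext a b
  fin_cases a <;> fin_cases b <;> rfl

/-! ### Schur complements, the inverse Gram matrix and the dihedral angles. -/

namespace Tetrahedron

variable {κ : Geometry3} (T : Tetrahedron κ)

/-- The Gram matrix of the components of the vertices orthogonal to `v_i` and `v_j`. -/
noncomputable def schur (i j k l : Fin 4) : ℝ :=
  T.gram k l - (κ.curv * T.gram i k * T.gram i l - T.gram i j * T.gram i k * T.gram j l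
    - T.gram i j * T.gram j k * T.gram i l + κ.curv * T.gram j k * T.gram j l)
      / (1 - T.gram i j ^ 2)

theorem one_sub_gram_sq_ne_zero {i j : Fin 4} (hij : i ≠ j) : 1 - T.gram i j ^ 2 ≠ 0 := by
  intro h
  simpa [h] using T.curv_mul_one_sub_gram_sq_pos hij

theorem form_perp_perp_eq_schur {i j : Fin 4} (hij : i ≠ j) (k l : Fin 4) :
    κ.form (κ.perp (κ.perp (T.vertex i) (T.vertex j)) (κ.perp (T.vertex i) (T.vertex k)))
      (κ.perp (κ.perp (T.vertex i) (T.vertex j)) (κ.perp (T.vertex i) (T.vertex l))) =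
      T.schur i j k l := by
  have h1 := T.one_sub_gram_sq_ne_zero hij
  have h2 : -1 + T.gram i j ^ 2 ≠ 0 := fun h => h1 (by linarith)
  have hc : κ.curv = 1 ∨ κ.curv = -1 := by cases κ <;> simp [Geometry3.curv]
  simp only [Geometry3.perp, κ.form_sub_smul_left, κ.form_sub_smul_right, ← gram_apply, gram_self,
    schur, T.gram_comm j i, T.gram_comm k i, T.gram_comm l i, T.gram_comm k j, T.gram_comm l j]
  generalize T.gram i j = b at *
  rcases hc with hc | hc
  -- `e` is the norm of the component of v_j orthogonal to v_i, simplified so that `field_simp`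
  -- recognizes a nonzero denominator.
  · have e : 1 - b / 1 * b - b / 1 * (b - b / 1 * 1) = 1 - b ^ 2 := by ring
    simp only [hc, e]
    field_simp
    ring
  · have e : -1 - b / -1 * b - b / -1 * (b - b / -1 * -1) = -1 + b ^ 2 := by ring
    have e' : 1 - b ^ 2 = -(-1 + b ^ 2) := by ring
    simp only [hc, e, e']
    field_simp
    ring

theorem schur_comm (i j k l : Fin 4) : T.schur i j k l = T.schur i j l k := by
  simp only [schur, T.gram_comm k l]; ring

/-- The determinant of a Schur complement is det G divided by that of the removed block, here curv²
- G_ij² = 1 - G_ij². -/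
theorem schur_det {i j k l : Fin 4} (hij : i ≠ j) (hik : i ≠ k) (hil : i ≠ l)
    (hjk : j ≠ k) (hjl : j ≠ l) (hkl : k ≠ l) :
    T.schur i j k k * T.schur i j l l - T.schur i j k l ^ 2 =
      T.gram.det / (1 - T.gram i j ^ 2) := by
  have h1 := T.one_sub_gram_sq_ne_zero hij
  have hc : κ.curv = 1 ∨ κ.curv = -1 := by cases κ <;> simp [Geometry3.curv]
  rw [det_four_distinct hij hik hil hjk hjl hkl]
  simp only [Matrix.det_succ_row_zero, Fin.sum_univ_succ, schur, gram_self, T.gram_comm j i,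
    T.gram_comm k i, T.gram_comm l i, T.gram_comm k j, T.gram_comm l j, T.gram_comm l k]
  simp [Matrix.submatrix, Fin.succAbove]
  rcases hc with hc | hc <;> rw [hc] <;> field_simp <;> ring

theorem gram_mul_inv : T.gram * T.gram⁻¹ = 1 :=
  Matrix.mul_nonsing_inv _ (isUnit_iff_ne_zero.mpr T.det_gram_ne_zero)

theorem gram_inv_comm (p q : Fin 4) : T.gram⁻¹ p q = T.gram⁻¹ q p := by
  have h : T.gram.transpose = T.gram := by ext p q; exact T.gram_comm q p
  conv_lhs => rw [← h, ← Matrix.transpose_nonsing_inv]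
  rfl

/-- Block elimination of the rows i and j in column k of G * G⁻¹ = 1. With m = k and m = l it shows
how the {k,l} block of G⁻¹ inverts the Schur complement. -/
theorem schur_mul_gram_inv {i j k l : Fin 4} (hij : i ≠ j) (hik : i ≠ k) (hil : i ≠ l)
    (hjk : j ≠ k) (hjl : j ≠ l) (hkl : k ≠ l) (m : Fin 4) :
    T.schur i j m k * T.gram⁻¹ k k + T.schur i j m l * T.gram⁻¹ l k =
      (1 : Matrix (Fin 4) (Fin 4) ℝ) m k := by
  have row : ∀ r, T.gram r i * T.gram⁻¹ i k + T.gram r j * T.gram⁻¹ j k +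
      T.gram r k * T.gram⁻¹ k k + T.gram r l * T.gram⁻¹ l k =
      (1 : Matrix (Fin 4) (Fin 4) ℝ) r k := fun r => by
    rw [← T.gram_mul_inv, Matrix.mul_apply, sum_four_distinct hij hik hil hjk hjl hkl]
  have ei := row i
  have ej := row j
  have em := row m
  rw [Matrix.one_apply_ne hik, T.gram_self] at ei
  rw [Matrix.one_apply_ne hjk, T.gram_self, T.gram_comm j i] at ej
  rw [T.gram_comm m i, T.gram_comm m j] at em
  have h1 := T.one_sub_gram_sq_ne_zero hij
  have hs : (1 - T.gram i j ^ 2)⁻¹ * (1 - T.gram i j ^ 2) = 1 := inv_mul_cancel₀ h1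
  have hc := κ.curv_mul_self
  simp only [schur, div_eq_mul_inv]
  generalize (1 - T.gram i j ^ 2)⁻¹ = s at *
  -- The multipliers of `ei` and `ej` are the row (G_mi, G_mj) times the inverse of the {i,j} block,
  -- which is s * [[curv, -G_ij], [-G_ij, curv]].
  linear_combination em - s * (κ.curv * T.gram i m - T.gram i j * T.gram j m) * ei
    - s * (κ.curv * T.gram j m - T.gram i j * T.gram i m) * ej
    + (T.gram i m * T.gram⁻¹ i k + T.gram j m * T.gram⁻¹ j k) * hs
    + s * (T.gram i m * T.gram⁻¹ i k + T.gram j m * T.gram⁻¹ j k) * hc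

theorem schur_det_pos {i j : Fin 4} (hij : i ≠ j) : 0 < T.gram.det / (1 - T.gram i j ^ 2) := by
  rw [← mul_div_mul_left _ _ κ.curv_ne_zero]
  exact div_pos T.curv_mul_det_gram_pos (T.curv_mul_one_sub_gram_sq_pos hij)

/-- The entry is the norm of a vector tangent at v_i, so only its vanishing has to be excluded; that
would make the 2×2 determinant nonpositive. -/
theorem schur_self_pos {i j k l : Fin 4} (hij : i ≠ j) (hik : i ≠ k) (hil : i ≠ l)
    (hjk : j ≠ k) (hjl : j ≠ l) (hkl : k ≠ l) : 0 < T.schur i j k k := by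
  have hD := T.schur_det_pos hij
  rw [← T.schur_det hij hik hil hjk hjl hkl] at hD
  have h0 : T.schur i j k k ≠ 0 := by
    intro h
    rw [h] at hD
    nlinarith [sq_nonneg (T.schur i j k l)]
  have hi := κ.form_self (T.vertex_mem i)
  have hi0 : κ.form (T.vertex i) (T.vertex i) ≠ 0 := hi ▸ κ.curv_ne_zero
  rw [← T.form_perp_perp_eq_schur hij] at h0 ⊢
  refine κ.form_pos hi ?_ ?_
  · rw [Geometry3.perp, κ.form_sub_smul_left, κ.form_perp_left hi0, κ.form_perp_left hi0]
    ring
  · intro h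
    apply h0
    rw [h]
    simp [Geometry3.form]

theorem gram_inv_self_mul {i j k l : Fin 4} (hij : i ≠ j) (hik : i ≠ k) (hil : i ≠ l)
    (hjk : j ≠ k) (hjl : j ≠ l) (hkl : k ≠ l) :
    T.gram⁻¹ k k * (T.gram.det / (1 - T.gram i j ^ 2)) = T.schur i j l l := by
  have hk := T.schur_mul_gram_inv hij hik hil hjk hjl hkl k
  have hl := T.schur_mul_gram_inv hij hik hil hjk hjl hkl l
  rw [Matrix.one_apply_eq] at hk
  rw [Matrix.one_apply_ne hkl.symm, T.schur_comm i j l k] at hl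
  rw [← T.schur_det hij hik hil hjk hjl hkl]
  linear_combination T.schur i j l l * hk - T.schur i j k l * hl

theorem gram_inv_mul {i j k l : Fin 4} (hij : i ≠ j) (hik : i ≠ k) (hil : i ≠ l)
    (hjk : j ≠ k) (hjl : j ≠ l) (hkl : k ≠ l) :
    T.gram⁻¹ k l * (T.gram.det / (1 - T.gram i j ^ 2)) = -T.schur i j k l := by
  have hk := T.schur_mul_gram_inv hij hik hil hjk hjl hkl k
  have hl := T.schur_mul_gram_inv hij hik hil hjk hjl hkl l
  rw [Matrix.one_apply_eq] at hk
  rw [Matrix.one_apply_ne hkl.symm, T.schur_comm i j l k] at hl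
  rw [← T.schur_det hij hik hil hjk hjl hkl, T.gram_inv_comm k l]
  linear_combination T.schur i j k k * hl - T.schur i j k l * hk

theorem gram_inv_self_pos (k : Fin 4) : 0 < T.gram⁻¹ k k := by
  obtain ⟨i, j, l, hij, hik, hil, hjk, hjl, hkl⟩ : ∃ i j l : Fin 4,
      i ≠ j ∧ i ≠ k ∧ i ≠ l ∧ j ≠ k ∧ j ≠ l ∧ k ≠ l := by
    revert k; decide
  have h := T.schur_self_pos hij hil hik hjl hjk hkl.symm
  rw [← T.gram_inv_self_mul hij hik hil hjk hjl hkl] at h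
  exact pos_of_mul_pos_left h (T.schur_det_pos hij).le

/-- `|sin (√curv * x_ij)|`. -/
noncomputable def absSin (i j : Fin 4) : ℝ := √(κ.curv * (1 - T.gram i j ^ 2))

theorem absSin_pos {i j : Fin 4} (hij : i ≠ j) : 0 < T.absSin i j :=
  Real.sqrt_pos.mpr (T.curv_mul_one_sub_gram_sq_pos hij)

theorem absSin_sq {i j : Fin 4} (hij : i ≠ j) :
    T.absSin i j ^ 2 = κ.curv * (1 - T.gram i j ^ 2) :=
  Real.sq_sqrt (T.curv_mul_one_sub_gram_sq_pos hij).le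

/-- The Schur complement is the adjugate of the {k,l} block of G⁻¹ times a positive factor, which
cancels in the cosine. The minus sign is that of the off-diagonal cofactor. -/
theorem dihedral_eq {i j k l : Fin 4} (hij : i ≠ j) (hik : i ≠ k) (hil : i ≠ l)
    (hjk : j ≠ k) (hjl : j ≠ l) (hkl : k ≠ l) :
    T.angles (edge hij) = Real.arccos (-(T.gram⁻¹ k l / (√(T.gram⁻¹ k k) * √(T.gram⁻¹ l l)))) := by
  rw [T.angles_edge hij hik hil hjk hjl hkl, Geometry3.dihedral, Geometry3.angle,
    T.form_perp_perp_eq_schur hij, T.form_perp_perp_eq_schur hij, T.form_perp_perp_eq_schur hij]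
  have hD := T.schur_det_pos hij
  have hk := T.gram_inv_self_mul hij hik hil hjk hjl hkl
  have hl := T.gram_inv_self_mul hij hil hik hjl hjk hkl.symm
  have hkl' := T.gram_inv_mul hij hik hil hjk hjl hkl
  have e : T.schur i j k l = -(T.gram⁻¹ k l * (T.gram.det / (1 - T.gram i j ^ 2))) := by
    rw [hkl', neg_neg]
  rw [e, ← hk, ← hl, Real.sqrt_mul (T.gram_inv_self_pos l).le,
    Real.sqrt_mul (T.gram_inv_self_pos k).le]
  have hk0 := Real.sqrt_pos.mpr (T.gram_inv_self_pos k)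
  have hl0 := Real.sqrt_pos.mpr (T.gram_inv_self_pos l)
  have hD0 := Real.sqrt_pos.mpr hD
  congr 1
  rw [neg_div]
  congr 1
  field_simp
  rw [Real.sq_sqrt hD.le]
  ring

/-- Jacobi's identity for complementary minors: the {k,l} minor of G⁻¹ is (1 - G_ij²)/det G. -/
theorem cos_aux_sq {i j k l : Fin 4} (hij : i ≠ j) (hik : i ≠ k) (hil : i ≠ l)
    (hjk : j ≠ k) (hjl : j ≠ l) (hkl : k ≠ l) :
    1 - (T.gram⁻¹ k l / (√(T.gram⁻¹ k k) * √(T.gram⁻¹ l l))) ^ 2 =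
      (T.absSin i j / (√(κ.curv * T.gram.det) * (√(T.gram⁻¹ k k) * √(T.gram⁻¹ l l)))) ^ 2 := by
  have hD := T.schur_det_pos hij
  have hk := T.gram_inv_self_mul hij hik hil hjk hjl hkl
  have hl := T.gram_inv_self_mul hij hil hik hjl hjk hkl.symm
  have hkl' := T.gram_inv_mul hij hik hil hjk hjl hkl
  have hdet := T.schur_det hij hik hil hjk hjl hkl
  have hk0 := (T.gram_inv_self_pos k)
  have hl0 := (T.gram_inv_self_pos l)
  have hd := T.curv_mul_det_gram_pos
  have hd0 := T.det_gram_ne_zero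
  have h1 := T.one_sub_gram_sq_ne_zero hij
  have hc := κ.curv_ne_zero
  rw [div_pow, div_pow, mul_pow, mul_pow, mul_pow, Real.sq_sqrt hk0.le, Real.sq_sqrt hl0.le,
    Real.sq_sqrt hd.le, T.absSin_sq hij]
  have key : (T.gram⁻¹ k k * T.gram⁻¹ l l - T.gram⁻¹ k l ^ 2) *
      (T.gram.det / (1 - T.gram i j ^ 2)) = 1 := by
    have : (T.gram⁻¹ k k * T.gram⁻¹ l l - T.gram⁻¹ k l ^ 2) *
      (T.gram.det / (1 - T.gram i j ^ 2)) * (T.gram.det / (1 - T.gram i j ^ 2)) =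
       1 * (T.gram.det / (1 - T.gram i j ^ 2)) := by
      have e : T.schur i j k l = -(T.gram⁻¹ k l * (T.gram.det / (1 - T.gram i j ^ 2))) := by
        rw [hkl', neg_neg]
      rw [← hk, ← hl, e] at hdet
      linear_combination hdet
    exact mul_right_cancel₀ hD.ne' this
  field_simp at key ⊢
  linear_combination key

theorem cos_angles {i j k l : Fin 4} (hij : i ≠ j) (hik : i ≠ k) (hil : i ≠ l)
    (hjk : j ≠ k) (hjl : j ≠ l) (hkl : k ≠ l) :
    Real.cos (T.angles (edge hij)) = -(T.gram⁻¹ k l / (√(T.gram⁻¹ k k) * √(T.gram⁻¹ l l))) := by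
  have h := T.cos_aux_sq hij hik hil hjk hjl hkl
  have h' : (T.gram⁻¹ k l / (√(T.gram⁻¹ k k) * √(T.gram⁻¹ l l))) ^ 2 ≤ 1 := by
    have := sq_nonneg
      (T.absSin i j / (√(κ.curv * T.gram.det) * (√(T.gram⁻¹ k k) * √(T.gram⁻¹ l l))))
    linarith
  have h'' := abs_le.mp ((sq_le_one_iff_abs_le_one _).mp h')
  rw [T.dihedral_eq hij hik hil hjk hjl hkl, Real.cos_arccos] <;> linarith

theorem sin_angles {i j k l : Fin 4} (hij : i ≠ j) (hik : i ≠ k) (hil : i ≠ l)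
    (hjk : j ≠ k) (hjl : j ≠ l) (hkl : k ≠ l) :
    Real.sin (T.angles (edge hij)) =
      T.absSin i j / (√(κ.curv * T.gram.det) * (√(T.gram⁻¹ k k) * √(T.gram⁻¹ l l))) := by
  rw [T.dihedral_eq hij hik hil hjk hjl hkl, Real.sin_arccos, neg_sq,
    T.cos_aux_sq hij hik hil hjk hjl hkl, Real.sqrt_sq]
  have := (T.absSin_pos hij).le
  positivity

/-- The sine of the angle is positive. Staying in this interval lets cosines determine angles. -/
theorem angles_mem_Ioo (e : Edge) : T.angles e ∈ Set.Ioo 0 Real.pi := by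
  obtain ⟨i, j, k, l, hij, hik, hil, hjk, hjl, hkl, rfl⟩ : ∃ (i j k l : Fin 4) (hij : i ≠ j),
      i ≠ k ∧ i ≠ l ∧ j ≠ k ∧ j ≠ l ∧ k ≠ l ∧ e = edge hij := by
    revert e; decide
  have hs := T.sin_angles hij hik hil hjk hjl hkl
  have hpos : 0 < Real.sin (T.angles (edge hij)) := by
    rw [hs]
    have := T.absSin_pos hij
    have := Real.sqrt_pos.mpr T.curv_mul_det_gram_pos
    have := Real.sqrt_pos.mpr (T.gram_inv_self_pos k)
    have := Real.sqrt_pos.mpr (T.gram_inv_self_pos l)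
    positivity
  have h0 : 0 ≤ T.angles (edge hij) := Real.arccos_nonneg _
  have hpi : T.angles (edge hij) ≤ Real.pi := Real.arccos_le_pi _
  refine ⟨h0.lt_of_ne ?_, hpi.lt_of_ne ?_⟩
  · intro h; rw [← h] at hpos; simp at hpos
  · intro h; rw [h] at hpos; simp at hpos

end Tetrahedron
/-! ### Lengths as an explicit function of the angles -/

/-- The matrix with `1` on the diagonal and `-cos a_ij` at the place `kl`, `{k, l}` being the
complement of `{i, j}`. -/
noncomputable def angleMatrix (a : Edge → ℝ) : Matrix (Fin 4) (Fin 4) ℝ :=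
  Matrix.of fun k l => if h : k = l then 1 else -Real.cos (a (edge h).opp)

theorem angleMatrix_self (a : Edge → ℝ) (k : Fin 4) : angleMatrix a k k = 1 := by
  simp [angleMatrix]

theorem angleMatrix_of_ne (a : Edge → ℝ) {k l : Fin 4} (h : k ≠ l) :
    angleMatrix a k l = -Real.cos (a (edge h).opp) := by
  simp [angleMatrix, h]

theorem edge_symm {i j : Fin 4} (h : i ≠ j) : edge h.symm = edge h :=
  Subtype.ext (Finset.pair_comm _ _)

theorem angleMatrix_comm (a : Edge → ℝ) (k l : Fin 4) : angleMatrix a k l = angleMatrix a l k := by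
  by_cases h : k = l
  · rw [h]
  · rw [angleMatrix_of_ne a h, angleMatrix_of_ne a (Ne.symm h), edge_symm h]

theorem angleMatrix_of_distinct (a : Edge → ℝ) {i j k l : Fin 4} (hij : i ≠ j) (hik : i ≠ k)
    (hil : i ≠ l) (hjk : j ≠ k) (hjl : j ≠ l) (hkl : k ≠ l) :
    angleMatrix a k l = -Real.cos (a (edge hij)) := by
  rw [angleMatrix_of_ne a hkl, edge_opp hkl hik.symm hjk.symm hil.symm hjl.symm hij]

namespace Geometry3

/-- The Gram matrix obtained by rescaling the inverse of `A` to have diagonal entries `curv`. -/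
noncomputable def normalizedInv (κ : Geometry3) (A : Matrix (Fin 4) (Fin 4) ℝ) :
    Matrix (Fin 4) (Fin 4) ℝ :=
  Matrix.of fun p q => A⁻¹ p q / (√(κ.curv * A⁻¹ p p) * √(κ.curv * A⁻¹ q q))

/-- The distance of two points as a function of their product under the form. -/
noncomputable def distOfForm : Geometry3 → ℝ → ℝ
  | spherical, g => Real.arccos g
  | hyperbolic, g => Real.arcosh (-g)

theorem gdist_eq_distOfForm (κ : Geometry3) (x y : Fin 4 → ℝ) :
    κ.gdist x y = κ.distOfForm (κ.form x y) := by
  cases κ <;> rfl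

/-- An explicit formula for the edge lengths in terms of the dihedral angles. -/
noncomputable def lengthFormula (κ : Geometry3) (a : Edge → ℝ) (e : Edge) : ℝ :=
  κ.distOfForm (κ.normalizedInv (angleMatrix a) e.fst e.snd)

end Geometry3

theorem edge_surj (e : Edge) : ∃ (i j k l : Fin 4) (hij : i ≠ j),
    i ≠ k ∧ i ≠ l ∧ j ≠ k ∧ j ≠ l ∧ k ≠ l ∧ e = edge hij := by
  revert e; decide

theorem ne_surj {k l : Fin 4} (hkl : k ≠ l) :
    ∃ i j : Fin 4, i ≠ j ∧ i ≠ k ∧ i ≠ l ∧ j ≠ k ∧ j ≠ l := by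
  revert k l; decide

/-- The inverse of a symmetric rescaling of an inverse matrix. -/
theorem inv_of_scaled_inv {A M : Matrix (Fin 4) (Fin 4) ℝ} (hA : A.det ≠ 0) {n : Fin 4 → ℝ}
    (hn : ∀ p, n p ≠ 0) (hM : ∀ p q, M p q = A⁻¹ p q / (n p * n q)) (p q : Fin 4) :
    M⁻¹ p q = A p q * (n p * n q) := by
  have e1 : M = Matrix.diagonal (fun p => (n p)⁻¹) * A⁻¹ * Matrix.diagonal (fun p => (n p)⁻¹) := by
    ext p q
    rw [Matrix.mul_diagonal, Matrix.diagonal_mul, hM]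
    have := hn p
    have := hn q
    field_simp
  have e2 : M⁻¹ = Matrix.diagonal n * A * Matrix.diagonal n := by
    apply Matrix.inv_eq_right_inv
    have hd : Matrix.diagonal (fun p => (n p)⁻¹) * Matrix.diagonal n = 1 := by
      rw [Matrix.diagonal_mul_diagonal, ← Matrix.diagonal_one]
      congr 1
      funext p
      exact inv_mul_cancel₀ (hn p)
    calc M * (Matrix.diagonal n * A * Matrix.diagonal n)
        = Matrix.diagonal (fun p => (n p)⁻¹) * (A⁻¹ *
          (Matrix.diagonal (fun p => (n p)⁻¹) * Matrix.diagonal n) * A) * Matrix.diagonal n := by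
          rw [e1]; simp only [Matrix.mul_assoc]
      _ = 1 := by
          rw [hd, Matrix.mul_one, Matrix.nonsing_inv_mul _ (isUnit_iff_ne_zero.mpr hA),
            Matrix.mul_one, hd]
  rw [e2, Matrix.mul_diagonal, Matrix.diagonal_mul]
  ring

namespace Tetrahedron

variable {κ : Geometry3} (T : Tetrahedron κ)

theorem sqrt_gram_inv_pos (k : Fin 4) : 0 < √(T.gram⁻¹ k k) :=
  Real.sqrt_pos.mpr (T.gram_inv_self_pos k)

theorem angleMatrix_angles (k l : Fin 4) :
    angleMatrix T.angles k l = T.gram⁻¹ k l / (√(T.gram⁻¹ k k) * √(T.gram⁻¹ l l)) := by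
  by_cases hkl : k = l
  · subst hkl
    rw [angleMatrix_self, Real.mul_self_sqrt (T.gram_inv_self_pos k).le,
      div_self (T.gram_inv_self_pos k).ne']
  · obtain ⟨i, j, hij, hik, hil, hjk, hjl⟩ := ne_surj hkl
    rw [angleMatrix_of_distinct _ hij hik hil hjk hjl hkl, T.cos_angles hij hik hil hjk hjl hkl,
      neg_neg]

theorem angleMatrix_angles_inv (p q : Fin 4) :
    (angleMatrix T.angles)⁻¹ p q = T.gram p q * (√(T.gram⁻¹ p p) * √(T.gram⁻¹ q q)) :=
  inv_of_scaled_inv T.det_gram_ne_zero (fun p => (T.sqrt_gram_inv_pos p).ne')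
    T.angleMatrix_angles p q

theorem curv_mul_angleMatrix_inv_self (p : Fin 4) :
    κ.curv * (angleMatrix T.angles)⁻¹ p p = T.gram⁻¹ p p := by
  rw [angleMatrix_angles_inv, gram_self, Real.mul_self_sqrt (T.gram_inv_self_pos p).le, ← mul_assoc,
    κ.curv_mul_self, one_mul]

theorem det_angleMatrix_ne_zero : (angleMatrix T.angles).det ≠ 0 := by
  intro h
  have h0 := T.angleMatrix_angles_inv 0 0
  -- A singular matrix has inverse 0 by convention, while the diagonal entry computed in `h0` is
  -- nonzero.
  rw [Matrix.nonsing_inv_apply_not_isUnit _ (by simp [h])] at h0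
  have := T.sqrt_gram_inv_pos 0
  rw [gram_self] at h0
  have := κ.curv_ne_zero
  have : κ.curv * (√(T.gram⁻¹ 0 0) * √(T.gram⁻¹ 0 0)) ≠ 0 := by positivity
  exact this h0.symm

theorem normalizedInv_angleMatrix : κ.normalizedInv (angleMatrix T.angles) = T.gram := by
  ext p q
  have hp := T.sqrt_gram_inv_pos p
  have hq := T.sqrt_gram_inv_pos q
  rw [Geometry3.normalizedInv, Matrix.of_apply, T.curv_mul_angleMatrix_inv_self,
    T.curv_mul_angleMatrix_inv_self, T.angleMatrix_angles_inv]
  field_simp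

theorem lengths_eq_lengthFormula : T.lengths = κ.lengthFormula T.angles := by
  funext e
  rw [Geometry3.lengthFormula, T.normalizedInv_angleMatrix, Tetrahedron.lengths,
    κ.gdist_eq_distOfForm]
  rfl

theorem lengths_eq_of_angles_eq {T' : Tetrahedron κ} (h : T'.angles = T.angles) :
    T'.lengths = T.lengths := by
  rw [lengths_eq_lengthFormula, lengths_eq_lengthFormula, h]

end Tetrahedron

theorem lengthsOfAngles_eq {κ : Geometry3} {a : Edge → ℝ}
    (h : a ∈ Set.range (Tetrahedron.angles (κ := κ))) :
    lengthsOfAngles κ a = κ.lengthFormula a := by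
  have h' : ∃ T : Tetrahedron κ, T.angles = a := h
  rw [lengthsOfAngles, dif_pos h', Tetrahedron.lengths_eq_lengthFormula, h'.choose_spec]

/-! ### Matrices with prescribed Gram matrix -/

section MatrixNorm

attribute [local instance] Matrix.linftyOpNormedRing Matrix.linftyOpNormedAlgebra

open scoped Matrix

/-- Symmetric matrices near `V₀ J V₀ᵀ` are of the form `V J Vᵀ` with `V` near `V₀`. -/
theorem eventually_exists_mul_mul_transpose {J V₀ : Matrix (Fin 4) (Fin 4) ℝ} (hJ : Jᵀ = J)
    (hJ' : IsUnit J) (hV : IsUnit V₀) {U : Set (Matrix (Fin 4) (Fin 4) ℝ)} (hU : U ∈ nhds V₀) :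
    ∀ᶠ S in nhds (V₀ * J * V₀ᵀ), Sᵀ = S → ∃ V ∈ U, V * J * Vᵀ = S := by
  let tr : Matrix (Fin 4) (Fin 4) ℝ →L[ℝ] Matrix (Fin 4) (Fin 4) ℝ :=
    LinearMap.toContinuousLinearMap
      (Matrix.transposeLinearEquiv (Fin 4) (Fin 4) ℝ ℝ).toLinearMap
  have hid := hasStrictFDerivAt_id (𝕜 := ℝ) V₀
  have htr' : HasStrictFDerivAt (fun V : Matrix (Fin 4) (Fin 4) ℝ => Vᵀ) tr V₀ :=
    tr.hasStrictFDerivAt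
  -- V ↦ V J Vᵀ has only symmetric values, so its derivative cannot be onto all matrices. Adding the
  -- skew term V J V₀ᵀ - V₀ J Vᵀ turns the derivative into H ↦ 2 H J V₀ᵀ, which is onto.
  have hg := (((hid.mul_const' J).mul' htr').add ((hid.mul_const' J).mul_const' V₀ᵀ)).sub
    (htr'.const_mul (V₀ * J))
  have hsurj := hg.map_nhds_eq_of_surj (by
    rw [LinearMap.range_eq_top]
    intro S
    have hVt : IsUnit V₀ᵀ := (Matrix.isUnit_transpose _).mpr hV
    refine ⟨(2 : ℝ)⁻¹ • (S * (V₀ᵀ)⁻¹ * J⁻¹), ?_⟩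
    have e : (2 : ℝ)⁻¹ • (S * (V₀ᵀ)⁻¹ * J⁻¹) * J * V₀ᵀ = (2 : ℝ)⁻¹ • S := by
      rw [smul_mul_assoc, smul_mul_assoc,
        Matrix.nonsing_inv_mul_cancel_right _ _ ((Matrix.isUnit_iff_isUnit_det _).mp hJ'),
        Matrix.nonsing_inv_mul_cancel_right _ _ ((Matrix.isUnit_iff_isUnit_det _).mp hVt)]
    generalize (2 : ℝ)⁻¹ • (S * (V₀ᵀ)⁻¹ * J⁻¹) = H at e ⊢
    have : V₀ * J * Hᵀ + H * J * V₀ᵀ + H * J * V₀ᵀ - V₀ * J * Hᵀ = S := by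
      rw [e]
      have : (2 : ℝ)⁻¹ • S + (2 : ℝ)⁻¹ • S = S := by
        rw [← add_smul]; norm_num
      nth_rw 3 [← this]
      abel
    exact this)
  have hU' := Filter.image_mem_map (m := fun V => V * J * Vᵀ + V * J * V₀ᵀ - V₀ * J * Vᵀ) hU
  replace hsurj : Filter.map (fun V => V * J * Vᵀ + V * J * V₀ᵀ - V₀ * J * Vᵀ) (nhds V₀) =
      nhds (V₀ * J * V₀ᵀ + V₀ * J * V₀ᵀ - V₀ * J * V₀ᵀ) := hsurj
  rw [hsurj, add_sub_cancel_right] at hU'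
  filter_upwards [hU'] with S hS hsymm
  obtain ⟨V, hVU, rfl⟩ := hS
  -- The value is symmetric by assumption, so the skew term vanishes and V J Vᵀ remains.
  refine ⟨V, hVU, ?_⟩
  simp only [Matrix.transpose_sub, Matrix.transpose_add, Matrix.transpose_mul,
    Matrix.transpose_transpose, hJ, ← Matrix.mul_assoc] at hsymm ⊢
  ext p q
  have := congrFun (congrFun hsymm p) q
  simp only [Matrix.add_apply, Matrix.sub_apply] at this ⊢
  linarith

/-! ### Derivatives of the inverse matrix -/

/-- Entrywise differentiability concerns the product norm, inversion the operator norm; the identity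
between them is linear in finite dimension, hence continuous. -/
theorem differentiableAt_matrix_of {E : Type*} [NormedAddCommGroup E] [NormedSpace ℝ E]
    {f : E → Matrix (Fin 4) (Fin 4) ℝ} {x : E} (h : ∀ p q, DifferentiableAt ℝ (fun y => f y p q) x) :
    DifferentiableAt ℝ f x := by
  have h1 : DifferentiableAt ℝ (fun y => (fun p q => f y p q : Fin 4 → Fin 4 → ℝ)) x :=
    differentiableAt_pi.mpr fun p => differentiableAt_pi.mpr fun q => h p q
  let L : (Fin 4 → Fin 4 → ℝ) →L[ℝ] Matrix (Fin 4) (Fin 4) ℝ :=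
    LinearMap.toContinuousLinearMap (Matrix.ofLinearEquiv ℝ).toLinearMap
  exact L.differentiableAt.comp x h1

theorem hasDerivAt_matrix_of {f : ℝ → Matrix (Fin 4) (Fin 4) ℝ} {f' : Matrix (Fin 4) (Fin 4) ℝ}
    {x : ℝ} (h : ∀ p q, HasDerivAt (fun y => f y p q) (f' p q) x) : HasDerivAt f f' x := by
  have h1 : HasDerivAt (fun y => (fun p q => f y p q : Fin 4 → Fin 4 → ℝ)) (fun p q => f' p q) x :=
    hasDerivAt_pi.mpr fun p => hasDerivAt_pi.mpr fun q => h p q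
  let L : (Fin 4 → Fin 4 → ℝ) →L[ℝ] Matrix (Fin 4) (Fin 4) ℝ :=
    LinearMap.toContinuousLinearMap (Matrix.ofLinearEquiv ℝ).toLinearMap
  exact L.hasFDerivAt.comp_hasDerivAt x h1

/-- Taking an entry, as a continuous linear map. -/
noncomputable def entryCLM (p q : Fin 4) : Matrix (Fin 4) (Fin 4) ℝ →L[ℝ] ℝ :=
  LinearMap.toContinuousLinearMap (Matrix.entryLinearMap ℝ ℝ p q)

theorem differentiableAt_inv_apply {E : Type*} [NormedAddCommGroup E] [NormedSpace ℝ E]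
    {f : E → Matrix (Fin 4) (Fin 4) ℝ} {x : E} (h : ∀ p q, DifferentiableAt ℝ (fun y => f y p q) x)
    (hx : (f x).det ≠ 0) (p q : Fin 4) : DifferentiableAt ℝ (fun y => (f y)⁻¹ p q) x := by
  have hu : IsUnit (f x) := (Matrix.isUnit_iff_isUnit_det _).mpr (isUnit_iff_ne_zero.mpr hx)
  have h1 : DifferentiableAt ℝ (Ring.inverse : Matrix (Fin 4) (Fin 4) ℝ → _) (f x) := by
    rw [← hu.unit_spec]
    exact (hasFDerivAt_ringInverse hu.unit).differentiableAt
  have h2 := (entryCLM p q).differentiableAt.comp x (h1.comp x (differentiableAt_matrix_of h))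
  simp only [Matrix.nonsing_inv_eq_ringInverse]
  exact h2

theorem hasDerivAt_inv_apply {f : ℝ → Matrix (Fin 4) (Fin 4) ℝ} {f' : Matrix (Fin 4) (Fin 4) ℝ}
    {x : ℝ} (h : ∀ p q, HasDerivAt (fun y => f y p q) (f' p q) x)
    (hx : (f x).det ≠ 0) (p q : Fin 4) :
    HasDerivAt (fun y => (f y)⁻¹ p q) (-((f x)⁻¹ * f' * (f x)⁻¹) p q) x := by
  have hu : IsUnit (f x) := (Matrix.isUnit_iff_isUnit_det _).mpr (isUnit_iff_ne_zero.mpr hx)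
  have h1 := hasFDerivAt_ringInverse (𝕜 := ℝ) hu.unit
  rw [hu.unit_spec] at h1
  have h2 := (entryCLM p q).hasFDerivAt.comp_hasDerivAt x
    (h1.comp_hasDerivAt x (hasDerivAt_matrix_of h))
  simp only [Matrix.nonsing_inv_eq_ringInverse]
  have : (↑(hu.unit⁻¹) : Matrix (Fin 4) (Fin 4) ℝ) = Ring.inverse (f x) := by
    conv_rhs => rw [← hu.unit_spec]
    rw [Ring.inverse_unit]
  rw [← this]
  exact h2

end MatrixNorm
-- Nearby angles are the angles of tetrahedra.
theorem differentiable_angleMatrix (p q : Fin 4) :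
    Differentiable ℝ (fun a : Edge → ℝ => angleMatrix a p q) := by
  by_cases h : p = q
  · subst h
    simp only [angleMatrix_self]
    fun_prop
  · simp only [angleMatrix_of_ne _ h]
    fun_prop

theorem Geometry3.mem_space_iff (κ : Geometry3) (x : Fin 4 → ℝ) :
    x ∈ κ.space ↔ κ.form x x = κ.curv ∧ (κ.curv = -1 → 0 < x 0) := by
  cases κ with
  | spherical =>
    simp only [Geometry3.space, Geometry3.curv, Set.mem_ofPred_eq]
    norm_num
  | hyperbolic => simp [Geometry3.space, Geometry3.curv]

namespace Tetrahedron

variable {κ : Geometry3} (T : Tetrahedron κ)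

theorem differentiableAt_angleMatrix_inv (p q : Fin 4) :
    DifferentiableAt ℝ (fun a => (angleMatrix a)⁻¹ p q) T.angles :=
  differentiableAt_inv_apply (fun p q => (differentiable_angleMatrix p q).differentiableAt)
    T.det_angleMatrix_ne_zero p q

theorem differentiableAt_normalizedInv (p q : Fin 4) :
    DifferentiableAt ℝ (fun a => κ.normalizedInv (angleMatrix a) p q) T.angles := by
  have h : ∀ r, DifferentiableAt ℝ (fun a => √(κ.curv * (angleMatrix a)⁻¹ r r)) T.angles := by
    intro r
    refine ((T.differentiableAt_angleMatrix_inv r r).const_mul _).sqrt ?_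
    rw [T.curv_mul_angleMatrix_inv_self]
    exact (T.gram_inv_self_pos r).ne'
  simp only [Geometry3.normalizedInv, Matrix.of_apply, div_eq_mul_inv]
  refine (T.differentiableAt_angleMatrix_inv p q).fun_mul (((h p).fun_mul (h q)).fun_inv ?_)
  simp only [T.curv_mul_angleMatrix_inv_self]
  exact (mul_pos (T.sqrt_gram_inv_pos p) (T.sqrt_gram_inv_pos q)).ne'

/-- For a near the given angles, the rescaled inverse of the angle matrix is symmetric and near G,
so it is the Gram matrix of nearby vertices. Inverting it gives back the angle matrix of a up to
scaling, so the new tetrahedron has the right cosines. -/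
theorem range_angles_mem_nhds : Set.range (Tetrahedron.angles (κ := κ)) ∈ nhds T.angles := by
  have hJ : IsUnit κ.ambient := IsUnit.of_mul_eq_one _ κ.ambient_mul_self
  have hV : IsUnit (Matrix.of T.vertex) :=
    (Matrix.isUnit_iff_isUnit_det _).mpr (isUnit_iff_ne_zero.mpr T.det_vertex_ne_zero)
  -- Independence of the vertices and, for H³, membership in the upper sheet are the open conditions
  -- that a Gram matrix does not impose by its diagonal.
  have hU : {V : Matrix (Fin 4) (Fin 4) ℝ | V.det ≠ 0 ∧ ∀ i, κ.curv = -1 → 0 < V i 0} ∈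
      nhds (Matrix.of T.vertex) := by
    refine Filter.inter_mem ?_ ?_
    · exact (continuous_id.matrix_det.isOpen_preimage _ isOpen_ne).mem_nhds T.det_vertex_ne_zero
    · refine Filter.eventually_all.mpr fun i => ?_
      by_cases hc : κ.curv = -1
      · have h0 : 0 < Matrix.of T.vertex i 0 := ((κ.mem_space_iff _).mp (T.vertex_mem i)).2 hc
        filter_upwards [(continuous_id.matrix_elem i 0).continuousAt.eventually_const_lt h0]
          with V hV _ using hV
      · exact Filter.Eventually.of_forall fun V h => absurd h hc
  have hgram := eventually_exists_mul_mul_transpose κ.ambient_transpose hJ hV hU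
  rw [← T.gram_eq_mul, ← T.normalizedInv_angleMatrix] at hgram
  have hcont : Filter.Tendsto (fun a => κ.normalizedInv (angleMatrix a)) (nhds T.angles)
      (nhds (κ.normalizedInv (angleMatrix T.angles))) :=
    tendsto_pi_nhds.mpr fun p => tendsto_pi_nhds.mpr fun q =>
      (T.differentiableAt_normalizedInv p q).continuousAt
  have hpos : ∀ᶠ a in nhds T.angles, ∀ p, 0 < κ.curv * (angleMatrix a)⁻¹ p p :=
    Filter.eventually_all.mpr fun p =>
      ((T.differentiableAt_angleMatrix_inv p p).continuousAt.const_mul _).eventually_const_lt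
        ((T.gram_inv_self_pos p).trans_eq (T.curv_mul_angleMatrix_inv_self p).symm)
  have hdet : ∀ᶠ a in nhds T.angles, (angleMatrix a).det ≠ 0 := by
    have : Continuous angleMatrix :=
      continuous_matrix fun p q => (differentiable_angleMatrix p q).continuous
    exact this.matrix_det.continuousAt.eventually_ne T.det_angleMatrix_ne_zero
  have hIoo : ∀ᶠ a in nhds T.angles, ∀ e, a e ∈ Set.Ioo 0 Real.pi :=
    Filter.eventually_all.mpr fun e =>
      (continuous_apply e).continuousAt (isOpen_Ioo.mem_nhds (T.angles_mem_Ioo e))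
  filter_upwards [hcont.eventually hgram, hpos, hdet, hIoo] with a hS hp hd hI
  have hsymm : (κ.normalizedInv (angleMatrix a)).transpose = κ.normalizedInv (angleMatrix a) := by
    have hA : (angleMatrix a).transpose = angleMatrix a := by
      ext p q; exact angleMatrix_comm a q p
    ext p q
    rw [Matrix.transpose_apply, Geometry3.normalizedInv, Matrix.of_apply, Matrix.of_apply,
      mul_comm √(κ.curv * (angleMatrix a)⁻¹ q q)]
    congr 1
    conv_lhs => rw [← hA, ← Matrix.transpose_nonsing_inv]
    rfl
  obtain ⟨V, ⟨hVdet, hVpos⟩, hVS⟩ := hS hsymm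
  have hform : ∀ p q, κ.form (V p) (V q) = κ.normalizedInv (angleMatrix a) p q := by
    intro p q
    rw [← κ.mul_ambient_mul_transpose, hVS]
  let T' : Tetrahedron κ :=
    { vertex := V
      vertex_mem := fun p => by
        refine (κ.mem_space_iff _).mpr ⟨?_, hVpos p⟩
        rw [hform, Geometry3.normalizedInv, Matrix.of_apply, Real.mul_self_sqrt (hp p).le]
        have h0 := κ.curv_ne_zero
        have h1 := (hp p).ne'
        rw [div_eq_iff h1, ← mul_assoc, κ.curv_mul_self, one_mul]
      linearIndependent := Matrix.linearIndependent_rows_iff_isUnit.mpr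
        ((Matrix.isUnit_iff_isUnit_det _).mpr (isUnit_iff_ne_zero.mpr hVdet)) }
  have hinv : ∀ p q, T'.gram⁻¹ p q = angleMatrix a p q *
      (√(κ.curv * (angleMatrix a)⁻¹ p p) * √(κ.curv * (angleMatrix a)⁻¹ q q)) :=
    inv_of_scaled_inv hd (fun p => (Real.sqrt_pos.mpr (hp p)).ne') fun p q => hform p q
  have hinv' : ∀ p, √(T'.gram⁻¹ p p) = √(κ.curv * (angleMatrix a)⁻¹ p p) := by
    intro p
    rw [hinv, angleMatrix_self, one_mul, Real.mul_self_sqrt (hp p).le]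
  refine ⟨T', funext fun e => ?_⟩
  refine Real.injOn_cos (Set.Ioo_subset_Icc_self (T'.angles_mem_Ioo e))
    (Set.Ioo_subset_Icc_self (hI e)) ?_
  obtain ⟨i, j, k, l, hij, hik, hil, hjk, hjl, hkl, rfl⟩ := edge_surj e
  rw [T'.cos_angles hij hik hil hjk hjl hkl, hinv', hinv', hinv,
    angleMatrix_of_distinct a hij hik hil hjk hjl hkl]
  have h1 := (Real.sqrt_pos.mpr (hp k)).ne'
  have h2 := (Real.sqrt_pos.mpr (hp l)).ne'
  field_simp

end Tetrahedron
/-! ### Lengths in terms of the Gram matrix, and their derivatives -/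

theorem Geometry3.sqrtCurv_mul_self (κ : Geometry3) : κ.sqrtCurv * κ.sqrtCurv = (κ.curv : ℂ) := by
  cases κ <;> simp [Geometry3.sqrtCurv, Geometry3.curv]

theorem Edge.fst_ne_snd (e : Edge) : e.fst ≠ e.snd := by
  revert e; decide

theorem edge_opp_eq_iff {i j k l : Fin 4} (hij : i ≠ j) (hik : i ≠ k)
    (hil : i ≠ l) (hjk : j ≠ k) (hjl : j ≠ l) (hkl : k ≠ l) {p q : Fin 4} (hpq : p ≠ q) :
    (edge hpq).opp = edge hij ↔ p = k ∧ q = l ∨ p = l ∧ q = k := by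
  have h1 : (edge hpq).opp = edge hij ↔ edge hpq = edge hkl := by
    rw [← edge_opp hkl hik.symm hjk.symm hil.symm hjl.symm hij]
    simp only [Edge.opp, compl_inj_iff, Subtype.ext_iff]
  rw [h1, edge, edge, Subtype.mk.injEq]
  clear hij hik hil hjk hjl h1
  revert p q k l; decide

/-- Cauchy–Schwarz for the spatial parts, whose squared norms are x₀² - 1 and y₀² - 1. -/
theorem Geometry3.form_hyperbolic_neg {x y : Fin 4 → ℝ} (hx : x ∈ Geometry3.hyperbolic.space)
    (hy : y ∈ Geometry3.hyperbolic.space) : Geometry3.hyperbolic.form x y < 0 := by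
  obtain ⟨hx1, hx0⟩ := hx
  obtain ⟨hy1, hy0⟩ := hy
  simp only [Geometry3.form, Geometry3.curv] at *
  have hcs : (x 1 * y 1 + x 2 * y 2 + x 3 * y 3) ^ 2 ≤
      (x 1 ^ 2 + x 2 ^ 2 + x 3 ^ 2) * (y 1 ^ 2 + y 2 ^ 2 + y 3 ^ 2) := by
    nlinarith [sq_nonneg (x 1 * y 2 - x 2 * y 1), sq_nonneg (x 1 * y 3 - x 3 * y 1),
      sq_nonneg (x 2 * y 3 - x 3 * y 2)]
  have e1 : x 1 ^ 2 + x 2 ^ 2 + x 3 ^ 2 = x 0 ^ 2 - 1 := by linarith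
  have e2 : y 1 ^ 2 + y 2 ^ 2 + y 3 ^ 2 = y 0 ^ 2 - 1 := by linarith
  have hy2 : 0 ≤ y 1 ^ 2 + y 2 ^ 2 + y 3 ^ 2 := by positivity
  have hlt : (x 1 * y 1 + x 2 * y 2 + x 3 * y 3) ^ 2 < (x 0 * y 0) ^ 2 := by
    rw [e1, e2] at hcs
    rw [e2] at hy2
    nlinarith [pow_pos hx0 2]
  have := abs_lt_of_sq_lt_sq hlt (by positivity)
  linarith [(abs_lt.mp this).2]

namespace Tetrahedron

variable {κ : Geometry3} (T : Tetrahedron κ)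

theorem lengths_edge_eq {i j : Fin 4} (h : i ≠ j) :
    T.lengths (edge h) = κ.distOfForm (T.gram i j) := by
  rw [T.lengths_edge h, κ.gdist_eq_distOfForm, gram_apply]

end Tetrahedron

theorem Tetrahedron.gram_lt_neg_one (T : Tetrahedron Geometry3.hyperbolic) {i j : Fin 4}
    (h : i ≠ j) : T.gram i j < -1 := by
  have h1 := T.curv_mul_one_sub_gram_sq_pos h
  have h2 := Geometry3.form_hyperbolic_neg (T.vertex_mem i) (T.vertex_mem j)
  rw [← T.gram_apply] at h2
  simp only [Geometry3.curv] at h1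
  nlinarith

theorem Tetrahedron.abs_gram_lt_one (T : Tetrahedron Geometry3.spherical) {i j : Fin 4}
    (h : i ≠ j) : |T.gram i j| < 1 := by
  have h1 := T.curv_mul_one_sub_gram_sq_pos h
  simp only [Geometry3.curv] at h1
  rw [← sq_lt_one_iff_abs_lt_one]
  linarith

namespace Tetrahedron

variable {κ : Geometry3} (T : Tetrahedron κ)

/-- As sin(ix) = i sinh x, the two geometries differ only in the factor √curv. -/
theorem sinLength_edge {i j : Fin 4} (h : i ≠ j) :
    T.sinLength (edge h) = κ.sqrtCurv * (T.absSin i j : ℂ) := by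
  rw [Tetrahedron.sinLength, T.lengths_edge_eq h, absSin]
  cases κ with
  | spherical =>
    simp only [Geometry3.sqrtCurv, Geometry3.distOfForm, Geometry3.curv, one_mul]
    rw [← Complex.ofReal_sin, Real.sin_arccos]
  | hyperbolic =>
    have := T.gram_lt_neg_one h
    simp only [Geometry3.sqrtCurv, Geometry3.distOfForm, Geometry3.curv]
    rw [mul_comm, Complex.sin_mul_I, ← Complex.ofReal_sinh, Real.sinh_arcosh (by linarith), mul_comm]
    congr 4
    ring

theorem cosLength_edge {i j : Fin 4} (h : i ≠ j) :
    T.cosLength (edge h) = ((κ.curv * T.gram i j : ℝ) : ℂ) := by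
  rw [Tetrahedron.cosLength, T.lengths_edge_eq h]
  cases κ with
  | spherical =>
    have := abs_lt.mp (T.abs_gram_lt_one h)
    simp only [Geometry3.sqrtCurv, Geometry3.distOfForm, Geometry3.curv, one_mul]
    rw [← Complex.ofReal_cos, Real.cos_arccos this.1.le this.2.le]
  | hyperbolic =>
    have := T.gram_lt_neg_one h
    simp only [Geometry3.sqrtCurv, Geometry3.distOfForm, Geometry3.curv]
    rw [mul_comm, Complex.cos_mul_I, ← Complex.ofReal_cosh, Real.cosh_arcosh (by linarith)]
    congr 1
    ring

theorem hasDerivAt_distOfForm {i j : Fin 4} (h : i ≠ j) :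
    HasDerivAt κ.distOfForm (-(T.absSin i j)⁻¹) (T.gram i j) := by
  rw [absSin]
  cases κ with
  | spherical =>
    have := abs_lt.mp (T.abs_gram_lt_one h)
    have := Real.hasDerivAt_arccos this.1.ne' this.2.ne
    exact this.congr_deriv (by simp [Geometry3.curv])
  | hyperbolic =>
    have := T.gram_lt_neg_one h
    have := (Real.hasDerivAt_arcosh (x := -T.gram i j) (Set.mem_Ioi.mpr (by linarith))).comp
      (T.gram i j) (hasDerivAt_neg _)
    exact this.congr_deriv (by simp [Geometry3.curv])

theorem sinLength_ne_zero (e : Edge) : T.sinLength e ≠ 0 := by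
  obtain ⟨i, j, -, -, hij, -, -, -, -, -, rfl⟩ := edge_surj e
  rw [T.sinLength_edge hij]
  refine mul_ne_zero ?_ (Complex.ofReal_ne_zero.mpr (T.absSin_pos hij).ne')
  intro h
  have := κ.sqrtCurv_mul_self
  rw [h, zero_mul] at this
  exact κ.curv_ne_zero (Complex.ofReal_eq_zero.mp this.symm)

/-- Outside the range of the angle map `lengthsOfAngles` has the default value 0, so differentiating
it requires a whole neighbourhood of realized angles. -/
theorem lengthsOfAngles_eventuallyEq :
    lengthsOfAngles κ =ᶠ[nhds T.angles] κ.lengthFormula := by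
  filter_upwards [T.range_angles_mem_nhds] with a ha using lengthsOfAngles_eq ha

theorem differentiableAt_lengthFormula : DifferentiableAt ℝ κ.lengthFormula T.angles := by
  refine differentiableAt_pi.mpr fun e => ?_
  have h := T.hasDerivAt_distOfForm (Edge.fst_ne_snd e)
  rw [← T.normalizedInv_angleMatrix] at h
  exact h.differentiableAt.comp T.angles (T.differentiableAt_normalizedInv e.fst e.snd)

theorem differentiableAt_lengthsOfAngles : DifferentiableAt ℝ (lengthsOfAngles κ) T.angles :=
  T.lengthsOfAngles_eventuallyEq.differentiableAt_iff.mpr T.differentiableAt_lengthFormula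

theorem dLength_eq_deriv (e f : Edge) :
    T.dLength e f = deriv (fun t : ℝ => κ.lengthFormula (T.angles + t • Pi.single f 1) e) 0 := by
  have h1 : (fun a => lengthsOfAngles κ a e) =ᶠ[nhds T.angles] fun a => κ.lengthFormula a e := by
    filter_upwards [T.lengthsOfAngles_eventuallyEq] with a ha
    rw [ha]
  rw [Tetrahedron.dLength, h1.fderiv_eq]
  exact ((differentiableAt_pi.mp T.differentiableAt_lengthFormula e).lineDeriv_eq_fderiv).symm

theorem hasDerivAt_angleMatrix {i j k l : Fin 4} (hij : i ≠ j) (hik : i ≠ k)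
    (hil : i ≠ l) (hjk : j ≠ k) (hjl : j ≠ l) (hkl : k ≠ l) (p q : Fin 4) :
    HasDerivAt (fun t : ℝ => angleMatrix (T.angles + t • Pi.single (edge hij) 1) p q)
      ((Real.sin (T.angles (edge hij)) • (Matrix.single k l (1 : ℝ) + Matrix.single l k 1) :
        Matrix (Fin 4) (Fin 4) ℝ) p q) 0 := by
  by_cases hpq : p = q
  · subst hpq
    simp only [angleMatrix_self]
    refine (hasDerivAt_const (0 : ℝ) (1 : ℝ)).congr_deriv ?_
    have h1 : ¬ (k = p ∧ l = p) := fun h => hkl (h.1.trans h.2.symm)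
    have h2 : ¬ (l = p ∧ k = p) := fun h => hkl (h.2.trans h.1.symm)
    simp [h1, h2]
  · simp only [angleMatrix_of_ne _ hpq, Pi.add_apply, Pi.smul_apply, smul_eq_mul]
    have h0 : HasDerivAt (fun t : ℝ => T.angles (edge hpq).opp +
        t * (Pi.single (edge hij) (1 : ℝ) : Edge → ℝ) (edge hpq).opp)
        ((Pi.single (edge hij) (1 : ℝ) : Edge → ℝ) (edge hpq).opp) 0 := by
      simpa using ((hasDerivAt_id (0 : ℝ)).mul_const
        ((Pi.single (edge hij) (1 : ℝ) : Edge → ℝ) (edge hpq).opp)).const_add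
          (T.angles (edge hpq).opp)
    refine h0.cos.fun_neg.congr_deriv ?_
    have hiff := edge_opp_eq_iff hij hik hil hjk hjl hkl hpq
    by_cases hc : (edge hpq).opp = edge hij
    · rw [hc]
      rcases hiff.mp hc with ⟨rfl, rfl⟩ | ⟨rfl, rfl⟩ <;>
        simp [hkl, hkl.symm]
    · have h1 : ¬ (k = p ∧ l = q) := fun h => hc (hiff.mpr (Or.inl ⟨h.1.symm, h.2.symm⟩))
      have h2 : ¬ (l = p ∧ k = q) := fun h => hc (hiff.mpr (Or.inr ⟨h.1.symm, h.2.symm⟩))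
      simp [h1, h2, Pi.single_eq_of_ne hc]

/-- From -A⁻¹A'A⁻¹. The scaling factors at k and l in the entries of A⁻¹ cancel the denominator of
sin a_ij. -/
theorem hasDerivAt_angleMatrix_inv {i j k l : Fin 4} (hij : i ≠ j) (hik : i ≠ k)
    (hil : i ≠ l) (hjk : j ≠ k) (hjl : j ≠ l) (hkl : k ≠ l) (p q : Fin 4) :
    HasDerivAt (fun t : ℝ => (angleMatrix (T.angles + t • Pi.single (edge hij) 1))⁻¹ p q)
      (-(T.absSin i j / √(κ.curv * T.gram.det) * (√(T.gram⁻¹ p p) * √(T.gram⁻¹ q q)) *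
        (T.gram p k * T.gram q l + T.gram p l * T.gram q k))) 0 := by
  have h := hasDerivAt_inv_apply (T.hasDerivAt_angleMatrix hij hik hil hjk hjl hkl)
    (by simpa using T.det_angleMatrix_ne_zero) p q
  refine h.congr_deriv ?_
  have hk := T.sqrt_gram_inv_pos k
  have hl := T.sqrt_gram_inv_pos l
  have hd := Real.sqrt_pos.mpr T.curv_mul_det_gram_pos
  simp only [zero_smul, add_zero, mul_add, add_mul, smul_add, Matrix.mul_smul,
    Matrix.add_apply, Matrix.smul_apply, smul_eq_mul, Matrix.mul_apply, Matrix.single_apply,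
    mul_ite, mul_one, mul_zero, ite_and, Finset.sum_ite_eq, Finset.mem_univ, if_true, ite_mul,
    zero_mul, T.sin_angles hij hik hil hjk hjl hkl]
  simp only [T.angleMatrix_angles_inv, T.gram_comm k, T.gram_comm l, Finset.sum_add_distrib, Finset.sum_ite_eq,
    Finset.mem_univ, if_true]
  field_simp

/-- The last term, with the factor curv * G_pq, comes from differentiating the two normalizing
square roots. -/
theorem hasDerivAt_normalizedInv {i j k l : Fin 4} (hij : i ≠ j) (hik : i ≠ k)
    (hil : i ≠ l) (hjk : j ≠ k) (hjl : j ≠ l) (hkl : k ≠ l) (p q : Fin 4) :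
    HasDerivAt
      (fun t : ℝ => κ.normalizedInv (angleMatrix (T.angles + t • Pi.single (edge hij) 1)) p q)
      (-(T.absSin i j / √(κ.curv * T.gram.det) * (T.gram p k * T.gram q l + T.gram p l * T.gram q k
        - κ.curv * T.gram p q * (T.gram p k * T.gram p l + T.gram q k * T.gram q l)))) 0 := by
  have hA := T.hasDerivAt_angleMatrix_inv hij hik hil hjk hjl hkl
  have hs : ∀ r, 0 < √(T.gram⁻¹ r r) := T.sqrt_gram_inv_pos
  have hne : ∀ r, κ.curv * (angleMatrix (T.angles + (0 : ℝ) • Pi.single (edge hij) 1))⁻¹ r r ≠ 0 := by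
    intro r
    rw [zero_smul, add_zero, T.curv_mul_angleMatrix_inv_self]
    exact (T.gram_inv_self_pos r).ne'
  have h1 := fun r => ((hA r r).const_mul κ.curv).sqrt (hne r)
  have h2 := (hA p q).fun_div ((h1 p).fun_mul (h1 q)) (by
    rw [zero_smul, add_zero, T.curv_mul_angleMatrix_inv_self, T.curv_mul_angleMatrix_inv_self]
    exact (mul_pos (hs p) (hs q)).ne')
  refine h2.congr_deriv ?_
  rw [zero_smul, add_zero, T.curv_mul_angleMatrix_inv_self, T.curv_mul_angleMatrix_inv_self,
    T.angleMatrix_angles_inv]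
  have hp := hs p
  have hq := hs q
  have hd := Real.sqrt_pos.mpr T.curv_mul_det_gram_pos
  field_simp
  ring

theorem dLength_edge {p q i j k l : Fin 4} (hpq : p ≠ q) (hij : i ≠ j) (hik : i ≠ k)
    (hil : i ≠ l) (hjk : j ≠ k) (hjl : j ≠ l) (hkl : k ≠ l) :
    T.dLength (edge hpq) (edge hij) =
      T.absSin i j / (√(κ.curv * T.gram.det) * T.absSin p q) *
        (T.gram p k * T.gram q l + T.gram p l * T.gram q k
        - κ.curv * T.gram p q * (T.gram p k * T.gram p l + T.gram q k * T.gram q l)) := by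
  have key : ∀ {p q : Fin 4} (hpq : p ≠ q),
      deriv (fun t : ℝ => κ.distOfForm
        (κ.normalizedInv (angleMatrix (T.angles + t • Pi.single (edge hij) 1)) p q)) 0 =
      T.absSin i j / (√(κ.curv * T.gram.det) * T.absSin p q) *
        (T.gram p k * T.gram q l + T.gram p l * T.gram q k
        - κ.curv * T.gram p q * (T.gram p k * T.gram p l + T.gram q k * T.gram q l)) := by
    intro p q hpq
    have h1 := T.hasDerivAt_distOfForm hpq
    have h2 := T.hasDerivAt_normalizedInv hij hik hil hjk hjl hkl p q
    have e : T.gram p q =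
        κ.normalizedInv (angleMatrix (T.angles + (0 : ℝ) • Pi.single (edge hij) 1)) p q := by
      rw [zero_smul, add_zero, T.normalizedInv_angleMatrix]
    rw [e] at h1
    refine (h1.comp 0 h2).deriv.trans ?_
    have := T.absSin_pos hpq
    have hd := Real.sqrt_pos.mpr T.curv_mul_det_gram_pos
    field_simp
  rw [T.dLength_eq_deriv]
  -- `lengthFormula` uses the sorted end points; the right-hand side is symmetric in p and q.
  rcases edge_cases hpq with ⟨h1, h2⟩ | ⟨h1, h2⟩
  · simp only [Geometry3.lengthFormula, h1, h2]
    exact key hpq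
  · simp only [Geometry3.lengthFormula, h1, h2]
    rw [key hpq.symm, absSin, absSin, absSin, T.gram_comm q p]
    ring

/-- The product of the two sines is curv * |s_pq| * |s_ij|: the factor |s_ij| cancels against the
derivative, and curv * |s_pq|² is 1 - G_pq². -/
theorem R_edge {p q i j k l : Fin 4} (hpq : p ≠ q) (hij : i ≠ j) (hik : i ≠ k)
    (hil : i ≠ l) (hjk : j ≠ k) (hjl : j ≠ l) (hkl : k ≠ l) :
    T.R (edge hpq) (edge hij) =
      (((T.gram p k * T.gram q l + T.gram p l * T.gram q k
        - κ.curv * T.gram p q * (T.gram p k * T.gram p l + T.gram q k * T.gram q l)) /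
          ((1 - T.gram p q ^ 2) * √(κ.curv * T.gram.det)) : ℝ) : ℂ) := by
  rw [Tetrahedron.R, T.sinLength_edge hpq, T.sinLength_edge hij,
    T.dLength_edge hpq hij hik hil hjk hjl hkl]
  have e : κ.sqrtCurv * (T.absSin p q : ℂ) * (κ.sqrtCurv * (T.absSin i j : ℂ)) =
      ((κ.curv * T.absSin p q * T.absSin i j : ℝ) : ℂ) := by
    push_cast
    rw [← κ.sqrtCurv_mul_self]
    ring
  rw [e, ← Complex.ofReal_one, ← Complex.ofReal_div, ← Complex.ofReal_mul]
  congr 1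
  have h1 := T.absSin_pos hpq
  have h2 := T.absSin_pos hij
  have hd := Real.sqrt_pos.mpr T.curv_mul_det_gram_pos
  have hG := T.one_sub_gram_sq_ne_zero hpq
  have hc := κ.curv_ne_zero
  have hS : κ.curv * T.absSin p q ^ 2 = 1 - T.gram p q ^ 2 := by
    rw [T.absSin_sq hpq, ← mul_assoc, κ.curv_mul_self, one_mul]
  rw [← hS]
  field_simp

/-- The angle at kl sits at place ij of the angle matrix, so the numerator is 1 + G_ij² - 2 G_ij²
and cancels. The result no longer depends on the edges. -/
theorem R_opposite {i j k l : Fin 4} (hij : i ≠ j) (hik : i ≠ k)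
    (hil : i ≠ l) (hjk : j ≠ k) (hjl : j ≠ l) (hkl : k ≠ l) :
    T.R (edge hij) (edge hkl) = ((1 / √(κ.curv * T.gram.det) : ℝ) : ℂ) := by
  rw [T.R_edge hij hkl hik.symm hjk.symm hil.symm hjl.symm hij]
  congr 1
  have hG := T.one_sub_gram_sq_ne_zero hij
  have hd := Real.sqrt_pos.mpr T.curv_mul_det_gram_pos
  rw [T.gram_self, T.gram_self, T.gram_comm j i]
  rw [div_eq_div_iff (by positivity) hd.ne']
  linear_combination (√(κ.curv * T.gram.det)) * (1 - 2 * T.gram i j ^ 2) * κ.curv_mul_self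

/-- The numerator factors as curv * G_il * (1 - G_ij²). What is left involves only the common vertex
i and the vertex l on neither edge. -/
theorem R_adjacent {i j k l : Fin 4} (hij : i ≠ j) (hik : i ≠ k)
    (hil : i ≠ l) (hjk : j ≠ k) (hjl : j ≠ l) (hkl : k ≠ l) :
    T.R (edge hij) (edge hik) = ((κ.curv * T.gram i l / √(κ.curv * T.gram.det) : ℝ) : ℂ) := by
  rw [T.R_edge hij hik hij hil hjk.symm hkl hjl]
  congr 1
  have hG := T.one_sub_gram_sq_ne_zero hij
  have hd := Real.sqrt_pos.mpr T.curv_mul_det_gram_pos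
  rw [T.gram_self]
  rw [div_eq_div_iff (by positivity) hd.ne']
  linear_combination
    (-√(κ.curv * T.gram.det) * T.gram i j * T.gram j l) * κ.curv_mul_self

theorem R_diagonal {i j k l : Fin 4} (hij : i ≠ j) (hik : i ≠ k)
    (hil : i ≠ l) (hjk : j ≠ k) (hjl : j ≠ l) (hkl : k ≠ l) :
    T.R (edge hij) (edge hij) = T.R (edge hij) (edge hkl) *
      ((-(T.cosLength (edge hij) * T.cosLength (edge hik) * T.cosLength (edge hil))
        - T.cosLength (edge hij.symm) * T.cosLength (edge hjk) * T.cosLength (edge hjl)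
        + T.cosLength (edge hik) * T.cosLength (edge hjl)
        + T.cosLength (edge hil) * T.cosLength (edge hjk)) / T.sinLength (edge hij) ^ 2) := by
  have hS : T.sinLength (edge hij) ^ 2 = ((1 - T.gram i j ^ 2 : ℝ) : ℂ) := by
    rw [T.sinLength_edge hij, mul_pow, pow_two κ.sqrtCurv, κ.sqrtCurv_mul_self, ← Complex.ofReal_pow,
      T.absSin_sq hij, ← Complex.ofReal_mul, ← mul_assoc, κ.curv_mul_self, one_mul]
  rw [T.R_opposite hij hik hil hjk hjl hkl, T.R_edge hij hij hik hil hjk hjl hkl, hS, edge_symm hij,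
    T.cosLength_edge, T.cosLength_edge, T.cosLength_edge, T.cosLength_edge, T.cosLength_edge]
  norm_cast
  have hG := T.one_sub_gram_sq_ne_zero hij
  have hd := Real.sqrt_pos.mpr T.curv_mul_det_gram_pos
  rw [div_mul_div_comm, mul_comm (1 - _) √_]
  congr 1
  linear_combination (κ.curv * T.gram i j * (T.gram i k * T.gram i l + T.gram j k * T.gram j l)
    - T.gram i k * T.gram j l - T.gram i l * T.gram j k) * κ.curv_mul_self

end Tetrahedron

/-! ### Pairs of edges up to relabelling, and the theorem. -/

theorem edge_six_cases {i j k l : Fin 4} (hij : i ≠ j) (hik : i ≠ k) (hil : i ≠ l) (hjk : j ≠ k)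
    (hjl : j ≠ l) (hkl : k ≠ l) (f : Edge) : f = edge hij ∨ f = edge hik ∨ f = edge hil ∨
      f = edge hjk ∨ f = edge hjl ∨ f = edge hkl := by
  obtain ⟨p, q, -, -, hpq, -, -, -, -, -, rfl⟩ := edge_surj f
  simp only [edge, Subtype.mk.injEq]
  revert i j k l p q; decide

theorem edge_pair_cases (e f : Edge) : ∃ (i j k l : Fin 4) (hij : i ≠ j) (hik : i ≠ k)
    (_ : i ≠ l) (_ : j ≠ k) (_ : j ≠ l) (hkl : k ≠ l),
    e = edge hij ∧ (f = edge hij ∨ f = edge hik ∨ f = edge hkl) := by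
  obtain ⟨i, j, k, l, hij, hik, hil, hjk, hjl, hkl, rfl⟩ := edge_surj e
  rcases edge_six_cases hij hik hil hjk hjl hkl f with h | h | h | h | h | h
  · exact ⟨i, j, k, l, hij, hik, hil, hjk, hjl, hkl, rfl, .inl h⟩
  · exact ⟨i, j, k, l, hij, hik, hil, hjk, hjl, hkl, rfl, .inr (.inl h)⟩
  · exact ⟨i, j, l, k, hij, hil, hik, hjl, hjk, hkl.symm, rfl, .inr (.inl h)⟩
  · exact ⟨j, i, k, l, hij.symm, hjk, hjl, hik, hil, hkl, (edge_symm hij).symm, .inr (.inl h)⟩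
  · exact ⟨j, i, l, k, hij.symm, hjl, hjk, hil, hik, hkl.symm, (edge_symm hij).symm,
      .inr (.inl h)⟩
  · exact ⟨i, j, k, l, hij, hik, hil, hjk, hjl, hkl, rfl, .inr (.inr h)⟩

end ConstCurv

theorem theorem2p2 (κ : Geometry3) (T : Tetrahedron κ) :
    -- the lengths are determined by the angles, and are differentiable functions of the
    -- angles, which are defined on a neighbourhood of the angles of the tetrahedron
    (∀ T' : Tetrahedron κ, T'.angles = T.angles → T'.lengths = T.lengths) ∧
    (Set.range (Tetrahedron.angles (κ := κ)) ∈ nhds T.angles) ∧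
    DifferentiableAt ℝ (lengthsOfAngles κ) T.angles ∧
    (∀ e : Edge, T.sinLength e ≠ 0) ∧
    -- symmetry (Schläfli)
    (∀ e f : Edge, T.R e f = T.R f e) ∧
    (∀ (i j k l : Fin 4) (hij : i ≠ j) (hik : i ≠ k) (hil : i ≠ l)
        (hjk : j ≠ k) (hjl : j ≠ l) (hkl : k ≠ l),
      -- the three pairs of opposite edges
      (T.R (edge hij) (edge hkl) = T.R (edge hik) (edge hjl) ∧
        T.R (edge hik) (edge hjl) = T.R (edge hil) (edge hjk)) ∧
      -- adjacent edges
      T.R (edge hij) (edge hik) = T.R (edge hij) (edge hkl) * T.cosLength (edge hil) ∧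
      -- diagonal terms
      T.R (edge hij) (edge hij) = T.R (edge hij) (edge hkl) *
        ((-(T.cosLength (edge hij) * T.cosLength (edge hik) * T.cosLength (edge hil))
          - T.cosLength (edge hij.symm) * T.cosLength (edge hjk) * T.cosLength (edge hjl)
          + T.cosLength (edge hik) * T.cosLength (edge hjl)
          + T.cosLength (edge hil) * T.cosLength (edge hjk)) / T.sinLength (edge hij) ^ 2)) ∧
    -- passing to opposite edges
    (∀ e f : Edge, e ≠ f → T.R e f = T.R e.opp f.opp) := by
  refine ⟨fun T' h => T.lengths_eq_of_angles_eq h, T.range_angles_mem_nhds,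
    T.differentiableAt_lengthsOfAngles, T.sinLength_ne_zero, fun e f => ?_,
    fun i j k l hij hik hil hjk hjl hkl => ⟨⟨?_, ?_⟩, ?_, ?_⟩, fun e f hef => ?_⟩
  · obtain ⟨i, j, k, l, hij, hik, hil, hjk, hjl, hkl, rfl, rfl | rfl | rfl⟩ := edge_pair_cases e f
    · rfl
    · rw [T.R_adjacent hij hik hil hjk hjl hkl, T.R_adjacent hik hij hil hjk.symm hkl hjl]
    · rw [T.R_opposite hij hik hil hjk hjl hkl,
        T.R_opposite hkl hik.symm hjk.symm hil.symm hjl.symm hij]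
  · rw [T.R_opposite hij hik hil hjk hjl hkl, T.R_opposite hik hij hil hjk.symm hkl hjl]
  · rw [T.R_opposite hik hij hil hjk.symm hkl hjl, T.R_opposite hil hij hik hjl.symm hkl.symm hjk]
  · rw [T.R_adjacent hij hik hil hjk hjl hkl, T.R_opposite hij hik hil hjk hjl hkl,
      T.cosLength_edge hil, ← Complex.ofReal_mul]
    congr 1
    ring
  · exact T.R_diagonal hij hik hil hjk hjl hkl
  · obtain ⟨i, j, k, l, hij, hik, hil, hjk, hjl, hkl, rfl, rfl | rfl | rfl⟩ := edge_pair_cases e f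
    · exact absurd rfl hef
    -- The complements lk and lj share l and miss i, so passing to opposite edges swaps the roles of
    -- i and l and G_il = G_li concludes.
    · rw [edge_opp hij hik hil hjk hjl hkl, edge_opp hik hij hil hjk.symm hkl hjl,
        ← edge_symm hkl, ← edge_symm hjl, T.R_adjacent hij hik hil hjk hjl hkl,
        T.R_adjacent hkl.symm hjl.symm hil.symm hjk.symm hik.symm hij.symm, T.gram_comm l i]
    · rw [edge_opp hij hik hil hjk hjl hkl, edge_opp hkl hik.symm hjk.symm hil.symm hjl.symm hij,
        T.R_opposite hij hik hil hjk hjl hkl,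
        T.R_opposite hkl hik.symm hjk.symm hil.symm hjl.symm hij]
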